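/- Let $d, d_1, d_2$ be integers with $1 \le d_1 \le d/2$ and $d_2 = d - d_1$, put $S = \mathbb{C}[x,y,z]$, and let $$f(x,y,z) = x^d + x^{d_2+1} y^{d_1-1} + y^{d-1} z .$$ Let $J_f = (f_x, f_y, f_z) \subseteq S$ be the Jacobian ideal of $f$, let $\widehat{J_f}$ be its saturation with respect to the ideal $(x,y,z)$, let $N(f) = \widehat{J_f}/J_f$, and let $AR(f) = \{(a,b,c) \in S^3 : a f_x + b f_y + c f_z = 0\}$. A reduced curve $f=0$ in $\mathbb{P}^2$ is called nearly free if $N(f) \ne 0$ and $\dim_{\mathbb{C}} N(f)_k \le 1$ for every $k$; its exponents are $(d_1,d_2)$, where $d_1 \le d_2$, if the graded $S$-module $AR(f)$ has a minimal system of three homogeneous generators, of degrees $d_1, d_2, d_2$. Then $f$ is homogeneous of degree $d$ and irreducible, and the curve $C : f = 0$ in $\mathbb{P}^2$ has the following properties. 1. $C$ is nearly free with exponents $(d_1, d_2)$. 2. $C$ is rational, that is, its function field is isomorphic to $\mathbb{C}(t)$ over $\mathbb{C}$. If $d \ge 3$, then $C$ has exactly one singular point; this point is a cusp (a unibranch singularity),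 and it has a unique Puiseux pair, namely $(d-1, d)$. -/

import Mathlib

open MvPolynomial

noncomputable section

namespace PlaneCurve

/-- The graded polynomial ring `S = ℂ[x, y, z]`, with `x = X 0`, `y = X 1`, `z = X 2`. -/
abbrev S : Type := MvPolynomial (Fin 3) ℂ

/-- The complex projective plane. -/
abbrev P2 : Type := Projectivization ℂ (Fin 3 → ℂ)

/-! ### Nearly free curves -/

/-- The Jacobian ideal `J_f = (f_x, f_y, f_z)`. -/
def jacobianIdeal (f : S) : Ideal S :=
  Ideal.span (Set.range fun i : Fin 3 => pderiv i f)

/-- The saturation of an ideal with respect to the maximal ideal `(x, y, z)`: all `g` such that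
`(x, y, z) ^ n * g ⊆ I` for some `n`. -/
def saturation (I : Ideal S) : Ideal S where
  carrier := {g | ∃ n : ℕ, ∀ h ∈ Ideal.span (Set.range (X : Fin 3 → S)) ^ n, h * g ∈ I}
  zero_mem' := ⟨0, fun h _ => by simp⟩
  add_mem' := by
    rintro a b ⟨n, hn⟩ ⟨m, hm⟩
    refine ⟨n + m, fun h hh => ?_⟩
    rw [mul_add]
    exact I.add_mem (hn h (Ideal.pow_le_pow_right (Nat.le_add_right n m) hh))
      (hm h (Ideal.pow_le_pow_right (Nat.le_add_left m n) hh))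
  smul_mem' := by
    rintro c a ⟨n, hn⟩
    refine ⟨n, fun h hh => ?_⟩
    have := I.mul_mem_left c (hn h hh)
    rwa [smul_eq_mul, mul_left_comm]

/-- The degree `k` part of the graded module `N(f) = (saturation of J_f) / J_f`, as a complex
subspace of the Milnor algebra `S / J_f`. -/
def jacobianModulePart (f : S) (k : ℕ) : Submodule ℂ (S ⧸ jacobianIdeal f) :=
  Submodule.map (Ideal.Quotient.mkₐ ℂ (jacobianIdeal f)).toLinearMap
    ((saturation (jacobianIdeal f)).restrictScalars ℂ ⊓ homogeneousSubmodule (Fin 3) ℂ k)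

/-- The reduced plane curve `f = 0` is nearly free: `N(f) ≠ 0`, and every graded piece of `N(f)`
has dimension at most one. -/
def IsNearlyFree (f : S) : Prop :=
  Squarefree f ∧ saturation (jacobianIdeal f) ≠ jacobianIdeal f ∧
    ∀ k : ℕ, Module.rank ℂ (jacobianModulePart f k) ≤ 1

/-- The graded module `AR(f)` of Jacobian syzygies: all `(a, b, c)` with
`a f_x + b f_y + c f_z = 0`. -/
def syzygies (f : S) : Submodule S (Fin 3 → S) where
  carrier := {r | ∑ i, r i * pderiv i f = 0}
  zero_mem' := by simp
  add_mem' := by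
    intro a b ha hb
    simp only [Set.mem_ofPred_eq, Pi.add_apply, add_mul, Finset.sum_add_distrib] at *
    rw [ha, hb, add_zero]
  smul_mem' := by
    intro c a ha
    simp only [Set.mem_ofPred_eq, Pi.smul_apply, smul_eq_mul, mul_assoc, ← Finset.mul_sum] at *
    rw [ha, mul_zero]

/-- The curve `f = 0` is nearly free with exponents `(d₁, d₂)`, `d₁ ≤ d₂`: it is nearly free, and
`AR(f)` has a minimal system of three homogeneous generators, of degrees `d₁, d₂, d₂`. -/
def IsNearlyFreeWithExponents (f : S) (d₁ d₂ : ℕ) : Prop :=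
  IsNearlyFree f ∧ d₁ ≤ d₂ ∧
    ∃ r : Fin 3 → Fin 3 → S,
      (∀ j i, (r j i).IsHomogeneous (![d₁, d₂, d₂] j)) ∧
      Submodule.span S (Set.range r) = syzygies f ∧
      ∀ j, r j ∉ Submodule.span S (r '' {j}ᶜ)

/-! ### Rational curves -/

/-- The ring of rational functions on the projective curve `f = 0`: fractions `a / b` of two
homogeneous elements of the same degree of `S / (f)`, with `b` not a zero divisor. When `f` is
irreducible and homogeneous this is the function field of the curve. -/
def functionField (f : S) : Subalgebra ℂ (FractionRing (S ⧸ Ideal.span {f})) where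
  carrier := {q | ∃ (n : ℕ) (a b : S), a.IsHomogeneous n ∧ b.IsHomogeneous n ∧
    Ideal.Quotient.mk (Ideal.span {f}) b ∈ nonZeroDivisors (S ⧸ Ideal.span {f}) ∧
    q * algebraMap _ (FractionRing (S ⧸ Ideal.span {f})) (Ideal.Quotient.mk (Ideal.span {f}) b) =
      algebraMap _ (FractionRing (S ⧸ Ideal.span {f})) (Ideal.Quotient.mk (Ideal.span {f}) a)}
  mul_mem' := by
    rintro p q ⟨n, a, b, ha, hb, hb0, hp⟩ ⟨m, c, e, hc, he, he0, hq⟩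
    refine ⟨n + m, a * c, b * e, ha.mul hc, hb.mul he, ?_, ?_⟩
    · rw [map_mul]; exact mul_mem hb0 he0
    · simp only [map_mul]
      rw [mul_mul_mul_comm, hp, hq]
  add_mem' := by
    rintro p q ⟨n, a, b, ha, hb, hb0, hp⟩ ⟨m, c, e, hc, he, he0, hq⟩
    refine ⟨n + m, a * e + b * c, b * e, (ha.mul he).add (hb.mul hc), hb.mul he, ?_, ?_⟩
    · rw [map_mul]; exact mul_mem hb0 he0
    · simp only [map_mul, map_add]
      rw [← hp, ← hq]; ring
  algebraMap_mem' := by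
    intro c
    refine ⟨0, C c, 1, isHomogeneous_C _ _, isHomogeneous_one _ _, by simp [one_mem], ?_⟩
    rw [map_one, map_one, mul_one]
    rfl

/-- The plane curve `f = 0` is a rational curve: it is irreducible, and its function field is
isomorphic over `ℂ` to the field `ℂ(t)` of rational functions in one variable. -/
def IsRational (f : S) : Prop :=
  Irreducible f ∧ Nonempty (functionField f ≃ₐ[ℂ] RatFunc ℂ)

/-! ### Cusps and Puiseux pairs -/

/-- `p` is a singular point of the curve `f = 0`, for `f` homogeneous. -/
def IsSingularPoint (f : S) (p : P2) : Prop :=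
  eval p.rep f = 0 ∧ ∀ i : Fin 3, eval p.rep (pderiv i f) = 0

/-- The frame `w` of `ℂ³` defines an affine chart `(u, v) ↦ [u w₀ + v w₁ + w₂]` of the projective
plane centred at `p`. -/
def IsFrameAt (w : Fin 3 → Fin 3 → ℂ) (p : P2) : Prop :=
  LinearIndependent ℂ w ∧ w 2 ∈ p.submodule

/-- The equation `f (u w₀ + v w₁ + w₂)` of the curve `f = 0` in the affine chart given by the
frame `w`, as a polynomial in `u = X 0` and `v = X 1`. -/
def localEquation (f : S) (w : Fin 3 → Fin 3 → ℂ) : MvPolynomial (Fin 2) ℂ :=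
  aeval (fun i : Fin 3 => C (w 0 i) * X 0 + C (w 1 i) * X 1 + C (w 2 i)) f

/-- A cusp of the curve `f = 0` is a unibranch singular point: the germ of the curve there is given
by an irreducible element of the ring `ℂ⟦u, v⟧`. -/
def IsCusp (f : S) (p : P2) : Prop :=
  IsSingularPoint f p ∧
    ∃ w, IsFrameAt w p ∧ Irreducible (localEquation f w : MvPowerSeries (Fin 2) ℂ)

/-- The germ of the curve `f = 0` at `p` is unibranch, and its branch has exactly one Puiseux pair,
namely `(m, n)`, where `2 ≤ m < n` and `gcd (m, n) = 1`: in suitable coordinates `(u, v)` at `p`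
the branch has a Puiseux parametrization `u = t ^ m`, `v = φ(t) = ∑ cⱼ t ^ j` in which `n` is the
least exponent that occurs with `cₙ ≠ 0` and is not divisible by `m`. As `n > m`, all exponents in
`φ` are at least `m`, so that `m` is the multiplicity of the germ; as `m` and `n` are coprime, the
parametrization is primitive and there is no further characteristic exponent. -/
def HasUniquePuiseuxPair (f : S) (p : P2) (m n : ℕ) : Prop :=
  2 ≤ m ∧ m < n ∧ m.Coprime n ∧
    ∃ w, IsFrameAt w p ∧ Irreducible (localEquation f w : MvPowerSeries (Fin 2) ℂ) ∧
      ∃ φ : PowerSeries ℂ, PowerSeries.coeff 0 φ = 0 ∧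
        aeval ![(PowerSeries.X : PowerSeries ℂ) ^ m, φ] (localEquation f w) = 0 ∧
        (∀ j < n, ¬ m ∣ j → PowerSeries.coeff j φ = 0) ∧ PowerSeries.coeff n φ ≠ 0

/-! ### The family of curves -/

/-- The polynomial `x ^ d + x ^ (d₂ + 1) y ^ (d₁ - 1) + y ^ (d - 1) z` (used only for `1 ≤ d₁` and
`1 ≤ d`, so that the subtractions do not truncate). -/
def curvePoly (d d₁ d₂ : ℕ) : S :=
  X 0 ^ d + X 0 ^ (d₂ + 1) * X 1 ^ (d₁ - 1) + X 1 ^ (d - 1) * X 2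

end PlaneCurve

end

noncomputable section

namespace PlaneCurve

/-! ### Polynomials modulo `(y, z)` -/

/-! Near freeness. The proof exhibits one form `g` together with vectors `A`, `B`, `D` whose
pairings with the gradient of `f` are `y g`, `z g` and `w g`, where `w = κ x ^ m`. Hence `(y, z, x ^
m) g ⊆ J_f`, and eliminating `g` gives three syzygies `zA - yB`, `yD - wA`, `zD - wB`. Once these
generate `AR(f)`, everything else is formal (`IsKoszulSystem`): comparing syzygies along the line `y
= z = 0`, where `A` and `B` stay independent, shows that the saturation is `(g) + J_f` and that `g ∉
J_f`. So `N(f)` is spanned by the classes of `x ^ i g`, at most one in each degree. The only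
relations between the three syzygies have coefficients vanishing at the origin, which gives
minimality. The degrees of `A`, `B` (`d₁ - 1`) and `D` (`d₂ - 1`) give the exponents. The systems
are written down explicitly in `isKoszulSystem_of_pderiv_monomial` (`d₁ = 1`) and
`isKoszulSystem_of_pderiv_binomial` (`d₁ ≥ 2`).

Geometry. The equation is linear in `z`, so the curve is irreducible, and `z / x` is a rational
function of `y / x`. Therefore `y / x` generates the function field. For `d ≥ 3` the partial
derivatives vanish together only at `[0 : 0 : 1]`. There the germ is `u ^ d + u ^ (d₂ + 1) v ^ (d₁ -
1) + v ^ (d - 1)`, whose Newton polygon is a segment with coprime side lengths `d` and `d - 1`; this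
forces irreducibility (`irreducible_of_newtonPolygon`). The parametrization `u = t ^ (d - 1)`, `v =
t ^ d ψ(t)`, with `ψ` a unit obtained by Hensel's lemma (`exists_puiseux_unit`), displays the
Puiseux pair. -/

/-- Restriction of a polynomial to the line `y = z = 0`. -/
def lineRestriction : S →ₐ[ℂ] Polynomial ℂ := aeval ![Polynomial.X, 0, 0]

@[simp] lemma lineRestriction_X_zero : lineRestriction (X 0) = Polynomial.X := by
  simp [lineRestriction]

@[simp] lemma lineRestriction_X_one : lineRestriction (X 1) = 0 := by
  simp [lineRestriction]

@[simp] lemma lineRestriction_X_two : lineRestriction (X 2) = 0 := by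
  simp [lineRestriction]

@[simp] lemma lineRestriction_C (c : ℂ) : lineRestriction (C c) = Polynomial.C c := by
  simp [lineRestriction]

lemma sub_aeval_lineRestriction_mem (p : S) :
    p - Polynomial.aeval (X 0 : S) (lineRestriction p) ∈ Ideal.span {(X 1 : S), X 2} := by
  rw [← Ideal.Quotient.eq]
  have h : Ideal.Quotient.mkₐ ℂ (Ideal.span {(X 1 : S), X 2}) =
      (Ideal.Quotient.mkₐ ℂ (Ideal.span {(X 1 : S), X 2})).comp
        ((Polynomial.aeval (X 0 : S)).comp lineRestriction) := by
    refine algHom_ext fun i => ?_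
    fin_cases i
    · simp
    · simpa using Ideal.Quotient.eq_zero_iff_mem.2
        (Ideal.subset_span (by simp : (X 1 : S) ∈ ({(X 1 : S), X 2} : Set S)))
    · simpa using Ideal.Quotient.eq_zero_iff_mem.2
        (Ideal.subset_span (by simp : (X 2 : S) ∈ ({(X 1 : S), X 2} : Set S)))
  exact DFunLike.congr_fun h p

lemma exists_eq_of_lineRestriction_eq_zero {p : S} (hp : lineRestriction p = 0) :
    ∃ a b : S, p = a * X 1 + b * X 2 := by
  have h := sub_aeval_lineRestriction_mem p
  rw [hp, map_zero, sub_zero, Ideal.mem_span_pair] at h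
  obtain ⟨a, b, h⟩ := h
  exact ⟨a, b, h.symm⟩

lemma X_dvd_of_X_mul_eq {i j : Fin 3} (hij : i ≠ j) {p q : S} (h : X i * p = X j * q) :
    (X j : S) ∣ p := by
  have h' : (X j : S) ∣ X i * p := ⟨q, h⟩
  refine ((X_prime (R := ℂ) (i := j)).dvd_or_dvd h').resolve_left fun h2 => ?_
  rw [X_dvd_X] at h2
  exact hij h2.symm

/-! ### Jacobian syzygies of Koszul type -/

/-- The map `S³ → S`, `(a, b, c) ↦ a f_x + b f_y + c f_z`. -/
def gradientMap (f : S) : (Fin 3 → S) →ₗ[S] S :=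
  Fintype.linearCombination S fun i => pderiv i f

lemma gradientMap_apply (f : S) (r : Fin 3 → S) : gradientMap f r = ∑ i, r i * pderiv i f := by
  simp [gradientMap, Fintype.linearCombination_apply]

lemma mem_syzygies {f : S} {r : Fin 3 → S} : r ∈ syzygies f ↔ gradientMap f r = 0 := by
  rw [gradientMap_apply]; rfl

lemma mem_jacobianIdeal {f p : S} : p ∈ jacobianIdeal f ↔ ∃ r, gradientMap f r = p := by
  rw [← LinearMap.mem_range, gradientMap, Fintype.range_linearCombination]
  rfl

/-- The three Koszul-type combinations of `A, B, D` with respect to the sequence `y, z, w`. -/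
def koszulSyzygies (A B D : Fin 3 → S) (w : S) : Fin 3 → Fin 3 → S :=
  ![(X 2 : S) • A - (X 1 : S) • B, (X 1 : S) • D - w • A, (X 2 : S) • D - w • B]

lemma mem_span_koszulSyzygies {A B D : Fin 3 → S} {w : S} {r : Fin 3 → S} :
    r ∈ Submodule.span S (Set.range (koszulSyzygies A B D w)) ↔
      ∃ α β γ : S, r = α • ((X 2 : S) • A - (X 1 : S) • B) + β • ((X 1 : S) • D - w • A) +
        γ • ((X 2 : S) • D - w • B) := by
  rw [Submodule.mem_span_range_iff_exists_fun]
  constructor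
  · rintro ⟨c, rfl⟩
    exact ⟨c 0, c 1, c 2, by simp [koszulSyzygies, Fin.sum_univ_three]⟩
  · rintro ⟨α, β, γ, rfl⟩
    exact ⟨![α, β, γ], by simp [koszulSyzygies, Fin.sum_univ_three]⟩

/-- The vectors `A, B, D` express `y g, z g, w g`, where `w = κ x ^ m`, as elements of the Jacobian
ideal of `f`, and the resulting Koszul-type syzygies generate all Jacobian syzygies. The last
conditions say that `A` and `B` are in triangular form modulo `(y, z)`. -/
structure IsKoszulSystem (f g : S) (A B D : Fin 3 → S) (κ : ℂ) (m k : ℕ) (a b : ℂ) : Prop where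
  gradient_A : gradientMap f A = X 1 * g
  gradient_B : gradientMap f B = X 2 * g
  gradient_D : gradientMap f D = C κ * X 0 ^ m * g
  κ_ne : κ ≠ 0
  m_ne : m ≠ 0
  a_ne : a ≠ 0
  b_ne : b ≠ 0
  restrict_A_one : lineRestriction (A 1) = 0
  restrict_A_two : lineRestriction (A 2) = Polynomial.C a * Polynomial.X ^ k
  restrict_B_one : lineRestriction (B 1) = Polynomial.C b * Polynomial.X ^ k
  restrict_B_two : lineRestriction (B 2) = 0
  syzygies_le : syzygies f ≤ Submodule.span S (Set.range (koszulSyzygies A B D (C κ * X 0 ^ m)))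

namespace IsKoszulSystem

variable {f g : S} {A B D : Fin 3 → S} {κ : ℂ} {m k : ℕ} {a b : ℂ}

lemma span_eq (h : IsKoszulSystem f g A B D κ m k a b) :
    Submodule.span S (Set.range (koszulSyzygies A B D (C κ * X 0 ^ m))) = syzygies f := by
  refine le_antisymm (fun r hr => ?_) h.syzygies_le
  obtain ⟨α, β, γ, rfl⟩ := mem_span_koszulSyzygies.1 hr
  rw [mem_syzygies]
  simp only [map_add, map_sub, map_smul, h.gradient_A, h.gradient_B, h.gradient_D, smul_eq_mul]
  ring

/-- On the line `y = z = 0` only the multiples of `A` and `B` survive. There `B` has the sole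
nonzero entry at index 1 and `A` the sole one at index 2 (among these two indices), so the
coefficients of `A` and `B` can be compared separately. -/
lemma restrict_combination (h : IsKoszulSystem f g A B D κ m k a b) {e e' α β γ : S}
    {P Q : Fin 3 → S}
    (H : (X 2 : S) • P + e • B - (X 1 : S) • Q - e' • A =
      α • ((X 2 : S) • A - (X 1 : S) • B) + β • ((X 1 : S) • D - (C κ * X 0 ^ m : S) • A) +
        γ • ((X 2 : S) • D - (C κ * X 0 ^ m : S) • B)) :
    lineRestriction (e + γ * (C κ * X 0 ^ m)) = 0 ∧
      lineRestriction (e' - β * (C κ * X 0 ^ m)) = 0 := by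
  have ha : Polynomial.C a * Polynomial.X ^ k ≠ 0 := by simp [h.a_ne]
  have hb : Polynomial.C b * Polynomial.X ^ k ≠ 0 := by simp [h.b_ne]
  constructor
  · have H1 := congrArg lineRestriction (congrFun H 1)
    simp [h.restrict_A_one, h.restrict_B_one] at H1
    refine (mul_eq_zero.1 ?_).resolve_right hb
    simp only [map_add, map_mul, map_pow, lineRestriction_C, lineRestriction_X_zero]
    linear_combination H1
  · have H1 := congrArg lineRestriction (congrFun H 2)
    simp [h.restrict_A_two, h.restrict_B_two] at H1
    refine (mul_eq_zero.1 ?_).resolve_right ha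
    simp only [map_sub, map_mul, map_pow, lineRestriction_C, lineRestriction_X_zero]
    linear_combination H1

lemma mul_mem_of_lineRestriction (h : IsKoszulSystem f g A B D κ m k a b) {e : S}
    (he : lineRestriction e = 0) : e * g ∈ jacobianIdeal f := by
  obtain ⟨u, v, rfl⟩ := exists_eq_of_lineRestriction_eq_zero he
  rw [mem_jacobianIdeal]
  refine ⟨u • A + v • B, ?_⟩
  simp only [map_add, map_smul, h.gradient_A, h.gradient_B, smul_eq_mul]
  ring

lemma mul_X_pow_mul_mem (h : IsKoszulSystem f g A B D κ m k a b) (γ : S) :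
    γ * (C κ * X 0 ^ m) * g ∈ jacobianIdeal f :=
  mem_jacobianIdeal.2 ⟨γ • D, by simp only [map_smul, h.gradient_D, smul_eq_mul]; ring⟩

lemma smul_X_eq {P Q : Fin 3 → S} (H : (X 2 : S) • P = (X 1 : S) • Q) :
    ∃ E : Fin 3 → S, P = (X 1 : S) • E := by
  have (i : Fin 3) : (X 1 : S) ∣ P i :=
    X_dvd_of_X_mul_eq (by decide : (2 : Fin 3) ≠ 1) (congrFun H i)
  choose E hE using this
  exact ⟨E, funext hE⟩

/-- If `y p` and `z p` are in the Jacobian ideal, then `p` is in `(g) + J_f`. -/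
lemma exists_of_X_mul_mem (h : IsKoszulSystem f g A B D κ m k a b) {p : S}
    (hy : X 1 * p ∈ jacobianIdeal f) (hz : X 2 * p ∈ jacobianIdeal f) :
    ∃ α : S, p - α * g ∈ jacobianIdeal f := by
  obtain ⟨P, hP⟩ := mem_jacobianIdeal.1 hy
  obtain ⟨Q, hQ⟩ := mem_jacobianIdeal.1 hz
  have hs : (X 2 : S) • P + (0 : S) • B - (X 1 : S) • Q - (0 : S) • A ∈ syzygies f := by
    rw [mem_syzygies]
    simp only [map_add, map_sub, map_smul, hP, hQ, smul_eq_mul]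
    ring
  obtain ⟨α, β, γ, H⟩ := mem_span_koszulSyzygies.1 (h.syzygies_le hs)
  obtain ⟨hγ, hβ⟩ := h.restrict_combination H
  have hκ : lineRestriction (C κ * X 0 ^ m) ≠ 0 := by simp [h.κ_ne]
  rw [zero_add, map_mul] at hγ
  rw [zero_sub, map_neg, neg_eq_zero, map_mul] at hβ
  obtain ⟨γ₁, γ₂, rfl⟩ :=
    exists_eq_of_lineRestriction_eq_zero ((mul_eq_zero.1 hγ).resolve_right hκ)
  obtain ⟨β₁, β₂, rfl⟩ :=
    exists_eq_of_lineRestriction_eq_zero ((mul_eq_zero.1 hβ).resolve_right hκ)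
  -- The `z`-parts of the terms in `β` and `γ` are moved to `P` and the `y`-parts to `Q`. These are
  -- multiples of syzygies, so they do not change the pairings with the gradient; what remains is an
  -- equation `z P' = y Q'`.
  obtain ⟨E, hE⟩ := smul_X_eq
    (P := P - α • A - β₂ • ((X 1 : S) • D - (C κ * X 0 ^ m : S) • A) -
      γ₂ • ((X 2 : S) • D - (C κ * X 0 ^ m : S) • B))
    (Q := Q - α • B + β₁ • ((X 1 : S) • D - (C κ * X 0 ^ m : S) • A) +
      γ₁ • ((X 2 : S) • D - (C κ * X 0 ^ m : S) • B)) (by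
      linear_combination (norm := module) H)
  refine ⟨α, mem_jacobianIdeal.2 ⟨E, ?_⟩⟩
  have hg := congrArg (gradientMap f) hE
  simp only [map_sub, map_smul, hP, h.gradient_A, h.gradient_B, h.gradient_D, smul_eq_mul] at hg
  refine mul_left_cancel₀ (X_ne_zero (R := ℂ) (1 : Fin 3)) ?_
  linear_combination -hg

/-- If `y p` and `z p` are in `(g) + J_f`, then so is `p`. -/
lemma exists_of_X_mul (h : IsKoszulSystem f g A B D κ m k a b) {p e e' : S}
    (hy : X 1 * p - e * g ∈ jacobianIdeal f) (hz : X 2 * p - e' * g ∈ jacobianIdeal f) :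
    ∃ α : S, p - α * g ∈ jacobianIdeal f := by
  obtain ⟨P, hP⟩ := mem_jacobianIdeal.1 hy
  obtain ⟨Q, hQ⟩ := mem_jacobianIdeal.1 hz
  have hs : (X 2 : S) • P + e • B - (X 1 : S) • Q - e' • A ∈ syzygies f := by
    rw [mem_syzygies]
    simp only [map_add, map_sub, map_smul, hP, hQ, h.gradient_A, h.gradient_B, smul_eq_mul]
    ring
  obtain ⟨α, β, γ, H⟩ := mem_span_koszulSyzygies.1 (h.syzygies_le hs)
  obtain ⟨h1, h2⟩ := h.restrict_combination H
  -- Both `(e + γ w) g` and `γ w g` lie in `J_f`, hence so does `e g`; likewise `e' g`. The previous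
  -- case then applies.
  have h1 := (jacobianIdeal f).sub_mem (h.mul_mem_of_lineRestriction h1) (h.mul_X_pow_mul_mem γ)
  have h2 := (jacobianIdeal f).add_mem (h.mul_mem_of_lineRestriction h2) (h.mul_X_pow_mul_mem β)
  refine h.exists_of_X_mul_mem ?_ ?_
  · convert (jacobianIdeal f).add_mem hy h1 using 1
    ring
  · convert (jacobianIdeal f).add_mem hz h2 using 1
    ring

/-- The ideal `(g) + J_f` is already saturated, since even multiplication by `y` and `z` alone
detects membership. The induction runs on the power of `(x, y, z)` carrying `p` into `(g) + J_f`, a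
weaker condition than landing in `J_f`. -/
lemma exists_of_mem_saturation (h : IsKoszulSystem f g A B D κ m k a b) {p : S}
    (hp : p ∈ saturation (jacobianIdeal f)) : ∃ α : S, p - α * g ∈ jacobianIdeal f := by
  obtain ⟨n, hn⟩ := hp
  have hn' : ∀ q ∈ Ideal.span (Set.range (X : Fin 3 → S)) ^ n,
      ∃ α : S, q * p - α * g ∈ jacobianIdeal f := fun q hq => ⟨0, by simpa using hn q hq⟩
  clear hn
  induction n generalizing p with
  | zero => simpa using hn' 1 (by simp)
  | succ n ih =>
    have key (i : Fin 3) : ∃ e : S, X i * p - e * g ∈ jacobianIdeal f := by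
      refine ih fun q hq => ?_
      obtain ⟨α, hα⟩ := hn' (q * X i) (by
        rw [pow_succ]
        exact Ideal.mul_mem_mul hq (Ideal.subset_span ⟨i, rfl⟩))
      exact ⟨α, by rwa [← mul_assoc]⟩
    obtain ⟨e, he⟩ := key 1
    obtain ⟨e', he'⟩ := key 2
    exact h.exists_of_X_mul he he'

/-- An element of `(x, y, z) ^ m` is a multiple of `x ^ m` modulo `(y, z)`, and `y`, `z`, `x ^ m`
all multiply `g` into `J_f`. -/
lemma mem_saturation (h : IsKoszulSystem f g A B D κ m k a b) :
    g ∈ saturation (jacobianIdeal f) := by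
  refine ⟨m, fun q hq => ?_⟩
  have hmap : Ideal.map lineRestriction (Ideal.span (Set.range (X : Fin 3 → S))) ≤
      Ideal.span {(Polynomial.X : Polynomial ℂ)} := by
    rw [Ideal.map_span, Ideal.span_le]
    rintro _ ⟨_, ⟨i, rfl⟩, rfl⟩
    fin_cases i <;> simp
  have hq' := Ideal.pow_right_mono hmap m
    (by rw [← Ideal.map_pow]; exact Ideal.mem_map_of_mem lineRestriction hq)
  rw [Ideal.span_singleton_pow, Ideal.mem_span_singleton] at hq'
  obtain ⟨t, ht⟩ := hq'
  obtain ⟨T, rfl⟩ : ∃ T, lineRestriction T = t :=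
    ⟨Polynomial.aeval (X 0) t, by
      rw [← AlgHom.comp_apply]
      exact DFunLike.congr_fun (Polynomial.algHom_ext (by simp) : _ = AlgHom.id ℂ _) t⟩
  have h1 := h.mul_mem_of_lineRestriction (e := q - C κ⁻¹ * T * (C κ * X 0 ^ m)) (by
    have : Polynomial.C κ⁻¹ * Polynomial.C κ = 1 := by
      rw [← Polynomial.C_mul, inv_mul_cancel₀ h.κ_ne, Polynomial.C_1]
    simp only [map_sub, map_mul, map_pow, lineRestriction_C, lineRestriction_X_zero, ht]
    linear_combination (-Polynomial.X ^ m * lineRestriction T) * this)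
  convert (jacobianIdeal f).add_mem h1 (h.mul_X_pow_mul_mem (C κ⁻¹ * T)) using 1
  ring

/-- If `g` were the pairing of `E` with the gradient, `A - yE` would be a syzygy; along the line
this makes `1` a multiple of `x ^ m`, impossible at the origin because `m ≠ 0`. -/
lemma not_mem (h : IsKoszulSystem f g A B D κ m k a b) : g ∉ jacobianIdeal f := by
  intro hg
  obtain ⟨E, hE⟩ := mem_jacobianIdeal.1 hg
  have hs : (X 2 : S) • (0 : Fin 3 → S) + (0 : S) • B - (X 1 : S) • E - (-1 : S) • A ∈
      syzygies f := by
    rw [mem_syzygies]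
    simp only [map_add, map_sub, map_smul, map_zero, hE, h.gradient_A, smul_eq_mul]
    ring
  obtain ⟨α, β, γ, H⟩ := mem_span_koszulSyzygies.1 (h.syzygies_le hs)
  have h2 := congrArg (Polynomial.eval 0) (h.restrict_combination H).2
  simp [h.m_ne] at h2

/-- Uniqueness of the relation among the Koszul-type syzygies: in every relation all coefficients
vanish at the origin. -/
lemma constantCoeff_relation (h : IsKoszulSystem f g A B D κ m k a b) {c : Fin 3 → S}
    (hc : ∑ i, c i • koszulSyzygies A B D (C κ * X 0 ^ m) i = 0) (i : Fin 3) :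
    Polynomial.eval 0 (lineRestriction (c i)) = 0 := by
  have hκ : lineRestriction (C κ * X 0 ^ m) ≠ 0 := by simp [h.κ_ne]
  have hw : (C κ * X 0 ^ m : S) ≠ 0 := fun h0 => hκ (by rw [h0, map_zero])
  obtain ⟨m, rfl⟩ := Nat.exists_eq_succ_of_ne_zero h.m_ne
  set w : S := C κ * X 0 ^ (m + 1) with hw_def
  -- The minor of the last two syzygies in the last two coordinates. It is nonzero along the line,
  -- so Cramer's rule yields `w c₁ = z c₀` and `w c₂ = -y c₀`, that is, proportionality to the
  -- Koszul relation.
  set Δ : S := (X 1 * D 1 - w * A 1) * (X 2 * D 2 - w * B 2) -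
    (X 2 * D 1 - w * B 1) * (X 1 * D 2 - w * A 2)
  have hΔ : Δ ≠ 0 := fun h0 => by
    have h1 := congrArg lineRestriction h0
    simp only [Δ, map_sub, map_mul, h.restrict_A_one, h.restrict_A_two, h.restrict_B_one,
      h.restrict_B_two, lineRestriction_X_one, lineRestriction_X_two] at h1
    refine mul_ne_zero (mul_ne_zero (pow_ne_zero 2 hκ) (by simpa using h.a_ne :
      Polynomial.C a * Polynomial.X ^ k ≠ 0)) (by simpa using h.b_ne :
      Polynomial.C b * Polynomial.X ^ k ≠ 0) ?_
    rw [map_zero] at h1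
    linear_combination -h1
  have hs (j : Fin 3) : c 0 * (X 2 * A j - X 1 * B j) + c 1 * (X 1 * D j - w * A j) +
      c 2 * (X 2 * D j - w * B j) = 0 := by
    simpa [koszulSyzygies, Fin.sum_univ_three] using congrFun hc j
  have h1 : w * c 1 = X 2 * c 0 := by
    refine mul_right_cancel₀ hΔ ?_
    linear_combination (w * (X 2 * D 2 - w * B 2)) * hs 1 - (w * (X 2 * D 1 - w * B 1)) * hs 2
  have h2 : w * c 2 = - (X 1 * c 0) := by
    refine mul_right_cancel₀ hΔ ?_
    linear_combination (w * (X 1 * D 1 - w * A 1)) * hs 2 - (w * (X 1 * D 2 - w * A 2)) * hs 1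
  have h0 : (X 0 : S) ∣ c 0 := X_dvd_of_X_mul_eq (by decide : (1 : Fin 3) ≠ 0)
    (q := -(C κ * X 0 ^ m * c 2)) (by rw [hw_def] at h2; linear_combination h2)
  fin_cases i
  · obtain ⟨t, ht⟩ := h0
    simp [ht]
  · have h3 := congrArg lineRestriction h1
    simp only [map_mul, lineRestriction_X_two, zero_mul] at h3
    simp [(mul_eq_zero.1 h3).resolve_left hκ]
  · have h3 := congrArg lineRestriction h2
    simp only [map_mul, map_neg, lineRestriction_X_one, zero_mul, neg_zero] at h3
    simp [(mul_eq_zero.1 h3).resolve_left hκ]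

/-- A redundant generator would give a relation with coefficient `-1` at `j`, which does not vanish
at the origin. -/
lemma notMem_span_image (h : IsKoszulSystem f g A B D κ m k a b) (j : Fin 3) :
    koszulSyzygies A B D (C κ * X 0 ^ m) j ∉
      Submodule.span S (koszulSyzygies A B D (C κ * X 0 ^ m) '' {j}ᶜ) := by
  intro hj
  obtain ⟨l, hl, hl'⟩ := (Finsupp.mem_span_image_iff_linearCombination S).1 hj
  have hlj : l j = 0 := by
    by_contra hne
    exact (Finsupp.mem_supported S l).1 hl (Finsupp.mem_support_iff.2 hne) rfl
  rw [Finsupp.linearCombination_apply, Finsupp.sum_fintype _ _ (by simp)] at hl'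
  have hrel := h.constantCoeff_relation (c := fun i => l i - if i = j then 1 else 0) (by
    simp only [sub_smul, Finset.sum_sub_distrib, hl']
    simp) j
  simp [hlj] at hrel

/-- Modulo `J_f` an element of the saturation is `α g`, and `α` matters only modulo `(y, z)`, so it
may be taken to be a polynomial in `x`. In degree `j` only the multiple of `x ^ (j - e) g` remains.
-/
lemma isNearlyFree (h : IsKoszulSystem f g A B D κ m k a b) (hf : Squarefree f) {n e : ℕ}
    (hfn : ∀ i, (pderiv i f).IsHomogeneous n) (hg : g.IsHomogeneous e) : IsNearlyFree f := by
  refine ⟨hf, fun heq => h.not_mem (heq ▸ h.mem_saturation), fun j => ?_⟩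
  rw [rank_submodule_le_one_iff']
  refine ⟨Ideal.Quotient.mk _ (X 0 ^ (j - e) * g), ?_⟩
  rintro _ ⟨p, ⟨hp, hpj⟩, rfl⟩
  obtain ⟨α, hα⟩ := h.exists_of_mem_saturation hp
  have hα' := h.mul_mem_of_lineRestriction
    (e := α - Polynomial.aeval (X 0 : S) (lineRestriction α)) (by
      rw [map_sub, sub_eq_zero, ← AlgHom.comp_apply]
      exact (DFunLike.congr_fun (Polynomial.algHom_ext (by simp) :
        lineRestriction.comp (Polynomial.aeval (X 0 : S)) = AlgHom.id ℂ _) _).symm)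
  let : GradedAlgebra (homogeneousSubmodule (Fin 3) ℂ) := gradedAlgebra
  have hJ : (jacobianIdeal f).IsHomogeneous (homogeneousSubmodule (Fin 3) ℂ) := by
    refine Ideal.homogeneous_span _ _ ?_
    rintro _ ⟨i, rfl⟩
    exact ⟨n, hfn i⟩
  set q := lineRestriction α
  have hpq : p - Polynomial.aeval (X 0 : S) q * g ∈ jacobianIdeal f := by
    convert (jacobianIdeal f).add_mem hα hα' using 1
    ring
  have hcomp : homogeneousComponent j (p - Polynomial.aeval (X 0 : S) q * g) ∈
      jacobianIdeal f := by
    rw [← decomposition.decompose'_apply]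
    exact hJ j hpq
  rw [map_sub, homogeneousComponent_of_mem hpj, if_pos rfl] at hcomp
  have hq : ∃ c : ℂ, homogeneousComponent j (Polynomial.aeval (X 0 : S) q * g) =
      c • (X 0 ^ (j - e) * g) := by
    induction q using Polynomial.induction_on' with
    | add q₁ q₂ h₁ h₂ =>
      obtain ⟨c₁, h₁⟩ := h₁
      obtain ⟨c₂, h₂⟩ := h₂
      exact ⟨c₁ + c₂, by rw [map_add, add_mul, map_add, h₁, h₂, add_smul]⟩
    | monomial i c =>
      have hi : (X 0 ^ i * g).IsHomogeneous (i + e) := by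
        simpa using ((isHomogeneous_X ℂ (0 : Fin 3)).pow i).mul hg
      rw [Polynomial.aeval_monomial, algebraMap_eq, mul_assoc, homogeneousComponent_C_mul,
        homogeneousComponent_of_mem hi]
      split_ifs with hij
      · exact ⟨c, by rw [hij, Nat.add_sub_cancel, smul_eq_C_mul]⟩
      -- This also covers `j < e`, where the exponent `j - e` truncates: no `i` has `i + e = j`, so
      -- the scalar is always zero.
      · exact ⟨0, by simp⟩
  obtain ⟨c, hc⟩ := hq
  rw [hc] at hcomp
  refine Submodule.mem_span_singleton.2 ⟨c, ?_⟩
  exact ((Ideal.Quotient.eq).2 hcomp).symm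

/-- A Koszul system with entries of the right degrees shows that the curve is nearly free. -/
lemma isNearlyFreeWithExponents (h : IsKoszulSystem f g A B D κ m k a b) (hf : Squarefree f)
    {n e d₁ d₂ : ℕ} (hfn : ∀ i, (pderiv i f).IsHomogeneous n) (hg : g.IsHomogeneous e)
    (hd : d₁ ≤ d₂) (hr : ∀ j i, (koszulSyzygies A B D (C κ * X 0 ^ m) j i).IsHomogeneous
      (![d₁, d₂, d₂] j)) : IsNearlyFreeWithExponents f d₁ d₂ :=
  ⟨h.isNearlyFree hf hfn hg, hd, _, hr, h.span_eq, h.notMem_span_image⟩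

end IsKoszulSystem
/-! ### Generators of the syzygies -/

lemma X_pow_dvd_of_mul_eq {i j : Fin 3} (hij : i ≠ j) {c : ℂ} (hc : c ≠ 0) {k l : ℕ} {p q : S}
    (h : C c * X i ^ k * p = X j ^ l * q) : (X j : S) ^ l ∣ p := by
  refine (X_prime (R := ℂ) (i := j)).pow_dvd_of_dvd_mul_left l (a := C c * X i ^ k) ?_
    ⟨q, h⟩
  intro h2
  rw [((isUnit_iff_ne_zero.2 hc).map C).dvd_mul_left] at h2
  have h3 := (X_prime (R := ℂ) (i := j)).dvd_of_dvd_pow h2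
  rw [X_dvd_X] at h3
  exact hij h3.symm

lemma eq_of_mem_syzygies {f : S} (hf : pderiv 2 f ≠ 0) {r r' : Fin 3 → S} (hr : r ∈ syzygies f)
    (hr' : r' ∈ syzygies f) (h0 : r 0 = r' 0) (h1 : r 1 = r' 1) : r = r' := by
  rw [mem_syzygies, gradientMap_apply, Fin.sum_univ_three] at hr hr'
  funext i
  fin_cases i
  · exact h0
  · exact h1
  · refine mul_right_cancel₀ hf ?_
    rw [h0, h1] at hr
    exact add_left_cancel (hr.trans hr'.symm)

/-- A Jacobian syzygy is determined by its first two entries. -/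
lemma mem_span_koszulSyzygies_of_eq {f g w : S} {A B D : Fin 3 → S} (hf : pderiv 2 f ≠ 0)
    (hA : gradientMap f A = X 1 * g) (hB : gradientMap f B = X 2 * g)
    (hD : gradientMap f D = w * g) {r : Fin 3 → S} (hr : r ∈ syzygies f) (α β γ : S)
    (h0 : r 0 = α * (X 2 * A 0 - X 1 * B 0) + β * (X 1 * D 0 - w * A 0) +
      γ * (X 2 * D 0 - w * B 0))
    (h1 : r 1 = α * (X 2 * A 1 - X 1 * B 1) + β * (X 1 * D 1 - w * A 1) +
      γ * (X 2 * D 1 - w * B 1)) :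
    r ∈ Submodule.span S (Set.range (koszulSyzygies A B D w)) := by
  refine mem_span_koszulSyzygies.2 ⟨α, β, γ, eq_of_mem_syzygies hf hr ?_ h0 h1⟩
  rw [mem_syzygies]
  simp only [map_add, map_sub, map_smul, hA, hB, hD, smul_eq_mul]
  ring

/-! ### Syzygies in the case `d₁ = 1`. -/

section Monomial

variable {f : S} {k : ℕ} {p e : ℂ}

/-- The Koszul system for a curve with gradient `(p x ^ (k + 1), e y ^ k z, y ^ (k + 1))`. -/
lemma isKoszulSystem_of_pderiv_monomial (hp : p ≠ 0) (he : e ≠ 0)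
    (h0 : pderiv 0 f = C p * X 0 ^ (k + 1)) (h1 : pderiv 1 f = C e * X 1 ^ k * X 2)
    (h2 : pderiv 2 f = X 1 ^ (k + 1)) :
    IsKoszulSystem f (C (e * p) * X 1 ^ k) ![0, 0, C (e * p)] ![0, C p, 0] ![C e * X 1 ^ k, 0, 0]
      1 (k + 1) 0 (e * p) p where
  gradient_A := by simp [gradientMap_apply, Fin.sum_univ_three, h2]; ring
  gradient_B := by simp [gradientMap_apply, Fin.sum_univ_three, h1]; ring
  gradient_D := by simp [gradientMap_apply, Fin.sum_univ_three, h0]; ring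
  κ_ne := one_ne_zero
  m_ne := k.succ_ne_zero
  a_ne := mul_ne_zero he hp
  b_ne := hp
  restrict_A_one := by simp
  restrict_A_two := by simp
  restrict_B_one := by simp
  restrict_B_two := by simp
  syzygies_le := by
    intro r hr
    have hr0 := hr
    rw [mem_syzygies, gradientMap_apply, Fin.sum_univ_three, h0, h1, h2] at hr
    have hpi : (C p * C p⁻¹ : S) = 1 := by rw [← C_mul, mul_inv_cancel₀ hp, C_1]
    have hei : (C e * C e⁻¹ : S) = 1 := by rw [← C_mul, mul_inv_cancel₀ he, C_1]
    obtain ⟨a, ha⟩ := X_pow_dvd_of_mul_eq (by decide : (0 : Fin 3) ≠ 1) hp (p := r 0)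
      (k := k + 1) (l := k) (q := -(C e * X 2 * r 1 + X 1 * r 2)) (by linear_combination hr)
    have hr' : C p * X 0 ^ (k + 1) * a + C e * r 1 * X 2 + r 2 * X 1 = 0 := by
      refine mul_left_cancel₀ (pow_ne_zero k (X_ne_zero (R := ℂ) (1 : Fin 3))) ?_
      rw [ha] at hr
      linear_combination hr
    -- After `y ^ k` is cancelled, the relation puts `x ^ (k + 1) a` in `(y, z)`, hence `a` as well.
    obtain ⟨u, v, rfl⟩ := exists_eq_of_lineRestriction_eq_zero (p := a) (by
      simpa [hp] using congrArg lineRestriction hr')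
    obtain ⟨t, ht⟩ := X_dvd_of_X_mul_eq (by decide : (2 : Fin 3) ≠ 1)
      (p := C p * X 0 ^ (k + 1) * v + C e * r 1) (q := - (C p * X 0 ^ (k + 1) * u + r 2))
      (by linear_combination hr')
    refine mem_span_koszulSyzygies_of_eq (g := C (e * p) * X 1 ^ k) (by simp [h2]) ?_ ?_ ?_ hr0
      (-(C e⁻¹ * C p⁻¹ * t)) (C e⁻¹ * u) (C e⁻¹ * v) ?_ ?_
    · simp [gradientMap_apply, Fin.sum_univ_three, h2]; ring
    · simp [gradientMap_apply, Fin.sum_univ_three, h1]; ring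
    · simp [gradientMap_apply, Fin.sum_univ_three, h0]; ring
    · simp only [Matrix.cons_val_zero, map_one]
      linear_combination ha - X 1 ^ k * (u * X 1 + v * X 2) * hei
    · simp only [Matrix.cons_val_one, Matrix.cons_val_zero, map_one]
      linear_combination C e⁻¹ * ht - r 1 * hei - C e⁻¹ * t * X 1 * hpi

end Monomial

/-! ### Syzygies in the case `d₁ ≥ 2`, with `n = d₁ - 2` and `k = d - 2 d₁`. -/

section Binomial

variable {f : S} {n k : ℕ} {p q e s : ℂ}

/-- With `h = p x ^ (n + 1) + q y ^ (n + 1)`, one has `f_x = x ^ (n + k + 2) h`. Comparing powers of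
`y` gives `y ^ n ∣ r₀`; what is left equates a multiple of `x ^ (n + k + 2)` with one of `y ^ (n + k
+ 2)`, and coprimality splits it into two equations through `t`. -/
lemma exists_of_mem_syzygies_binomial (hp : p ≠ 0)
    (h0 : pderiv 0 f = C p * X 0 ^ (2 * n + k + 3) + C q * X 0 ^ (n + k + 2) * X 1 ^ (n + 1))
    (h1 : pderiv 1 f = C s * X 0 ^ (n + k + 3) * X 1 ^ n + C e * X 1 ^ (2 * n + k + 2) * X 2)
    (h2 : pderiv 2 f = X 1 ^ (2 * n + k + 3)) {r : Fin 3 → S} (hr : r ∈ syzygies f) :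
    ∃ a t : S, r 0 = X 1 ^ n * a ∧
      a * (C p * X 0 ^ (n + 1) + C q * X 1 ^ (n + 1)) + C s * r 1 * X 0 = X 1 ^ (n + k + 2) * t ∧
      C 1 * X 0 ^ (n + k + 2) * t + C e * r 1 * X 2 + r 2 * X 1 = 0 := by
  rw [mem_syzygies, gradientMap_apply, Fin.sum_univ_three, h0, h1, h2] at hr
  obtain ⟨a, ha⟩ := X_pow_dvd_of_mul_eq (by decide : (0 : Fin 3) ≠ 1) hp (p := r 0)
    (k := 2 * n + k + 3) (l := n) (q := -(r 0 * C q * X 0 ^ (n + k + 2) * X 1 +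
      r 1 * (C s * X 0 ^ (n + k + 3) + C e * X 1 ^ (n + k + 2) * X 2) +
        r 2 * X 1 ^ (n + k + 3))) (by linear_combination hr)
  have hr' : C 1 * X 0 ^ (n + k + 2) *
      (a * (C p * X 0 ^ (n + 1) + C q * X 1 ^ (n + 1)) + C s * r 1 * X 0) =
      X 1 ^ (n + k + 2) * -(C e * r 1 * X 2 + r 2 * X 1) := by
    refine mul_left_cancel₀ (pow_ne_zero n (X_ne_zero (R := ℂ) (1 : Fin 3))) ?_
    rw [ha] at hr
    rw [C_1]
    linear_combination hr
  obtain ⟨t, ht⟩ := X_pow_dvd_of_mul_eq (by decide : (0 : Fin 3) ≠ 1) one_ne_zero hr'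
  refine ⟨a, t, ha, ht, ?_⟩
  refine mul_left_cancel₀ (pow_ne_zero (n + k + 2) (X_ne_zero (R := ℂ) (1 : Fin 3))) ?_
  rw [ht] at hr'
  linear_combination hr'

/-- A syzygy whose second entry is divisible by `y` has explicit first two entries. -/
lemma exists_of_mem_syzygies_binomial_of_dvd (hp : p ≠ 0) (hq : q ≠ 0) (hs : s ≠ 0)
    (h0 : pderiv 0 f = C p * X 0 ^ (2 * n + k + 3) + C q * X 0 ^ (n + k + 2) * X 1 ^ (n + 1))
    (h1 : pderiv 1 f = C s * X 0 ^ (n + k + 3) * X 1 ^ n + C e * X 1 ^ (2 * n + k + 2) * X 2)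
    (h2 : pderiv 2 f = X 1 ^ (2 * n + k + 3)) {r : Fin 3 → S} (hr : r ∈ syzygies f)
    (hr1 : (X 1 : S) ∣ r 1) :
    ∃ u v : S, r 0 = C s * X 1 ^ (n + 1) * (X 1 ^ (k + 1) * u + X 0 * v) ∧
      r 1 = - (C p * X 0 ^ n * X 1 ^ (k + 2) * u) -
        X 1 * (C p * X 0 ^ (n + 1) + C q * X 1 ^ (n + 1)) * v := by
  have hqi : (C q * C q⁻¹ : S) = 1 := by rw [← C_mul, mul_inv_cancel₀ hq, C_1]
  have hsi : (C s * C s⁻¹ : S) = 1 := by rw [← C_mul, mul_inv_cancel₀ hs, C_1]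
  obtain ⟨a, t, ha, ht, hrt⟩ := exists_of_mem_syzygies_binomial hp h0 h1 h2 hr
  obtain ⟨b, hb⟩ := hr1
  rw [hb] at ht hrt
  obtain ⟨t, rfl⟩ : (X 1 : S) ∣ t := by
    simpa using X_pow_dvd_of_mul_eq (by decide : (0 : Fin 3) ≠ 1) one_ne_zero
      (k := n + k + 2) (l := 1) (q := -(C e * b * X 2 + r 2)) (by linear_combination hrt)
  obtain ⟨a, rfl⟩ : (X 1 : S) ∣ a := by
    simpa using X_pow_dvd_of_mul_eq (by decide : (0 : Fin 3) ≠ 1) hp (k := n + 1) (l := 1)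
      (q := X 1 ^ (n + k + 2) * t - C s * b * X 0 - a * C q * X 1 ^ n)
      (by linear_combination ht)
  have ht' : a * (C p * X 0 ^ (n + 1) + C q * X 1 ^ (n + 1)) + C s * b * X 0 =
      X 1 ^ (n + k + 2) * t := by
    refine mul_left_cancel₀ (X_ne_zero (R := ℂ) (1 : Fin 3)) ?_
    linear_combination ht
  -- Modulo `x` the equation `ht'` reads `y ^ (n + 1) (q a - y ^ (k + 1) t) = 0`.
  obtain ⟨v, hv⟩ : (X 0 : S) ∣ C q * a - X 1 ^ (k + 1) * t := by
    simpa using X_pow_dvd_of_mul_eq (by decide : (1 : Fin 3) ≠ 0) one_ne_zero (k := n + 1)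
      (l := 1) (p := C q * a - X 1 ^ (k + 1) * t) (q := -(C s * b + C p * X 0 ^ n * a))
      (by rw [C_1]; linear_combination ht')
  refine ⟨C q⁻¹ * C s⁻¹ * t, C q⁻¹ * C s⁻¹ * v, ?_, ?_⟩
  · rw [ha]
    linear_combination X 1 ^ (n + 1) * C q⁻¹ * hv - X 1 ^ (n + 1) * a * hqi -
      X 1 ^ (n + 1) * C q⁻¹ * (X 1 ^ (k + 1) * t + X 0 * v) * hsi
  · rw [hb]
    have hb' : C q * C s * b = -(C p * X 0 ^ n * X 1 ^ (k + 1) * t) -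
        v * (C p * X 0 ^ (n + 1) + C q * X 1 ^ (n + 1)) := by
      refine mul_left_cancel₀ (X_ne_zero (R := ℂ) (0 : Fin 3)) ?_
      linear_combination C q * ht' - (C p * X 0 ^ (n + 1) + C q * X 1 ^ (n + 1)) * hv
    linear_combination X 1 * C q⁻¹ * C s⁻¹ * hb' - X 1 * b * C s * C s⁻¹ * hqi - X 1 * b * hsi

/-- The Koszul system for a curve with gradient
`(p x ^ (2n+k+3) + q x ^ (n+k+2) y ^ (n+1), s x ^ (n+k+3) y ^ n + e y ^ (2n+k+2) z, y ^ (2n+k+3))`.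
-/
lemma isKoszulSystem_of_pderiv_binomial (hp : p ≠ 0) (hq : q ≠ 0) (he : e ≠ 0) (hs : s ≠ 0)
    (h0 : pderiv 0 f = C p * X 0 ^ (2 * n + k + 3) + C q * X 0 ^ (n + k + 2) * X 1 ^ (n + 1))
    (h1 : pderiv 1 f = C s * X 0 ^ (n + k + 3) * X 1 ^ n + C e * X 1 ^ (2 * n + k + 2) * X 2)
    (h2 : pderiv 2 f = X 1 ^ (2 * n + k + 3)) :
    IsKoszulSystem f (C e * (C p * X 0 ^ (n + 1) + C q * X 1 ^ (n + 1)) * X 1 ^ (2 * n + k + 2))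
      ![0, 0, C e * (C p * X 0 ^ (n + 1) + C q * X 1 ^ (n + 1))]
      ![-(C s * X 0 * X 1 ^ n), C p * X 0 ^ (n + 1) + C q * X 1 ^ (n + 1), 0]
      ![C (p * e * s) * X 1 ^ (n + k + 1), -(C (p ^ 2 * e) * X 0 ^ n * X 1 ^ (k + 1)),
        C (p ^ 2 * e ^ 2) * X 0 ^ n * X 1 ^ k * X 2 + C (s * q ^ 2 * e) * X 0 ^ (k + 1) * X 1 ^ n]
      (s * q) (k + 1) (n + 1) (e * p) p where
  gradient_A := by simp [gradientMap_apply, Fin.sum_univ_three, h2]; ring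
  gradient_B := by simp [gradientMap_apply, Fin.sum_univ_three, h0, h1]; ring
  -- The first two entries of `D` cancel the terms in `x ^ (2n+k+3) y ^ (n+k+1)`. In the last entry,
  -- one summand removes the remaining `z`-term and the other completes the factor `p x ^ (n + 1) +
  -- q y ^ (n + 1)`.
  gradient_D := by simp [gradientMap_apply, Fin.sum_univ_three, h0, h1, h2]; ring
  κ_ne := mul_ne_zero hs hq
  m_ne := k.succ_ne_zero
  a_ne := mul_ne_zero he hp
  b_ne := hp
  restrict_A_one := by simp
  restrict_A_two := by simp [mul_assoc]
  restrict_B_one := by simp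
  restrict_B_two := by simp
  syzygies_le := by
    intro r hr
    obtain ⟨a, t, ha, ht, hrt⟩ := exists_of_mem_syzygies_binomial hp h0 h1 h2 hr
    have hpi : (C p * C p⁻¹ : S) = 1 := by rw [← C_mul, mul_inv_cancel₀ hp, C_1]
    have hei : (C e * C e⁻¹ : S) = 1 := by rw [← C_mul, mul_inv_cancel₀ he, C_1]
    obtain ⟨t₁, t₂, rfl⟩ := exists_eq_of_lineRestriction_eq_zero (p := t) (by
      simpa using congrArg lineRestriction hrt)
    -- Modulo `y`, the entry of `zD - wB` at index 1 is `-s q p x ^ (n + k + 2)`, while `hrt` makes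
    -- `e r₁` congruent to `-x ^ (n + k + 2) t₂`. With this scaling, subtracting `γ (zD - wB)`
    -- leaves an entry divisible by `y`.
    obtain ⟨γ, rfl⟩ : ∃ γ, t₂ = C (e * s * q * p) * γ := by
      refine ⟨C (e * s * q * p)⁻¹ * t₂, ?_⟩
      rw [← mul_assoc, ← C_mul, mul_inv_cancel₀ (by simp [*]), C_1, one_mul]
    obtain ⟨T, hT⟩ : (X 1 : S) ∣ X 0 ^ (n + k + 2) * (C (s * q * p) * γ) + r 1 := by
      simpa using X_pow_dvd_of_mul_eq (by decide : (2 : Fin 3) ≠ 1) he (k := 1) (l := 1)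
        (q := -(X 0 ^ (n + k + 2) * t₁ + r 2)) (by
          simp only [C_mul, C_1] at hrt ⊢
          linear_combination hrt)
    set A : Fin 3 → S := ![0, 0, C e * (C p * X 0 ^ (n + 1) + C q * X 1 ^ (n + 1))]
    set B : Fin 3 → S :=
      ![-(C s * X 0 * X 1 ^ n), C p * X 0 ^ (n + 1) + C q * X 1 ^ (n + 1), 0]
    set D : Fin 3 → S :=
      ![C (p * e * s) * X 1 ^ (n + k + 1), -(C (p ^ 2 * e) * X 0 ^ n * X 1 ^ (k + 1)),
        C (p ^ 2 * e ^ 2) * X 0 ^ n * X 1 ^ k * X 2 + C (s * q ^ 2 * e) * X 0 ^ (k + 1) * X 1 ^ n]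
    set g : S :=
      C e * (C p * X 0 ^ (n + 1) + C q * X 1 ^ (n + 1)) * X 1 ^ (2 * n + k + 2)
    have hA : gradientMap f A = X 1 * g := by
      simp [A, g, gradientMap_apply, Fin.sum_univ_three, h2]; ring
    have hB : gradientMap f B = X 2 * g := by
      simp [B, g, gradientMap_apply, Fin.sum_univ_three, h0, h1]; ring
    have hD : gradientMap f D = C (s * q) * X 0 ^ (k + 1) * g := by
      simp [D, g, gradientMap_apply, Fin.sum_univ_three, h0, h1, h2]; ring
    have hr' : r - γ • ((X 2 : S) • D - (C (s * q) * X 0 ^ (k + 1) : S) • B) ∈ syzygies f := by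
      rw [mem_syzygies] at hr ⊢
      simp only [map_sub, map_smul, hr, hB, hD, smul_eq_mul]
      ring
    obtain ⟨u, v, hu, hv⟩ := exists_of_mem_syzygies_binomial_of_dvd hp hq hs h0 h1 h2 hr' ⟨T +
      γ * (C (p ^ 2 * e) * X 0 ^ n * X 1 ^ k * X 2 + C (s * q) * C q * X 0 ^ (k + 1) * X 1 ^ n), by
        simp [B, D]
        simp only [C_mul] at hT
        linear_combination hT⟩
    refine mem_span_koszulSyzygies_of_eq (by simp [h2]) hA hB hD hr v (C p⁻¹ * C e⁻¹ * u) γ ?_ ?_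
    · simp [A, B, D] at hu ⊢
      linear_combination hu -
        C s * X 1 ^ (n + k + 2) * u * (C e * C e⁻¹ * hpi + hei)
    · simp [A, B, D] at hv ⊢
      linear_combination hv + C p * X 0 ^ n * X 1 ^ (k + 2) * u * (C e * C e⁻¹ * hpi + hei)

end Binomial

/-! ### The curves are irreducible and nearly free -/

lemma C_ofNat (n : ℕ) [n.AtLeastTwo] : (C (ofNat(n) : ℂ) : S) = ofNat(n) := map_ofNat C n

lemma isHomogeneous_monomial_mul {c : ℂ} (i j k n : ℕ) (h : i + j + k = n) :
    (C c * X 0 ^ i * X 1 ^ j * X 2 ^ k : S).IsHomogeneous n := by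
  subst h
  simpa using ((((isHomogeneous_C (Fin 3) c).mul ((isHomogeneous_X ℂ (0 : Fin 3)).pow i)).mul
    ((isHomogeneous_X ℂ (1 : Fin 3)).pow j)).mul ((isHomogeneous_X ℂ (2 : Fin 3)).pow k))

lemma curvePoly_isHomogeneous {d d₁ d₂ : ℕ} (h₁ : 1 ≤ d₁) (h : d₁ + d₂ = d) :
    (curvePoly d d₁ d₂).IsHomogeneous d := by
  have e₁ := isHomogeneous_monomial_mul (c := 1) d 0 0 d (by omega)
  have e₂ := isHomogeneous_monomial_mul (c := 1) (d₂ + 1) (d₁ - 1) 0 d (by omega)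
  have e₃ := isHomogeneous_monomial_mul (c := 1) 0 (d - 1) 1 d (by omega)
  simpa [curvePoly] using (e₁.add e₂).add e₃

/-- The polynomial is linear in `z`, and `y` does not divide its `z`-free part: at `(1, 0, 0)` that
part is `1`, or `2` when `d₁ - 1 = 0`. -/
lemma curvePoly_irreducible (d d₁ d₂ : ℕ) : Irreducible (curvePoly d d₁ d₂) := by
  have hX (n : ℕ) (i : Fin 3) (hi : i ≠ 2) : (2 : Fin 3) ∉ (X i ^ n : S).vars := fun hm => by
    have := vars_pow _ _ hm
    rw [vars_X, Finset.mem_singleton] at this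
    exact hi this.symm
  rw [curvePoly, add_comm]
  refine irreducible_mul_X_add _ _ 2 (by simp) (hX _ 1 (by decide)) (fun hm => ?_) ?_
  · rcases Finset.mem_union.1 (vars_add_subset _ _ hm) with hm | hm
    · exact hX _ 0 (by decide) hm
    · rcases Finset.mem_union.1 (vars_mul _ _ hm) with hm | hm
      · exact hX _ 0 (by decide) hm
      · exact hX _ 1 (by decide) hm
  · refine IsRelPrime.pow_left ?_
    rw [(X_prime (R := ℂ) (i := (1 : Fin 3))).irreducible.isRelPrime_iff_not_dvd]
    rintro ⟨t, ht⟩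
    have h2 := congrArg (eval ![1, 0, 0]) ht
    rcases Nat.eq_zero_or_pos (d₁ - 1) with h0 | h0
    · norm_num [h0] at h2
    · norm_num [h0.ne'] at h2

lemma IsKoszulSystem.isNearlyFreeWithExponents_of_isHomogeneous {f g : S} {A B D : Fin 3 → S}
    {κ : ℂ} {m k : ℕ} {a b : ℂ} (h : IsKoszulSystem f g A B D κ m k a b) (hf : Squarefree f)
    {d e u v : ℕ} (hfd : f.IsHomogeneous d) (hg : g.IsHomogeneous e)
    (hA : ∀ i, (A i).IsHomogeneous u) (hB : ∀ i, (B i).IsHomogeneous u)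
    (hD : ∀ i, (D i).IsHomogeneous v) (huv : v + 1 = m + u) (hle : u ≤ v) :
    IsNearlyFreeWithExponents f (u + 1) (v + 1) := by
  refine h.isNearlyFreeWithExponents hf (fun i => hfd.pderiv) hg (by omega) fun j i => ?_
  have hX (l : Fin 3) {p : S} {n : ℕ} (hp : p.IsHomogeneous n) :
      (X l * p).IsHomogeneous (n + 1) := by
    rw [add_comm]; exact (isHomogeneous_X ℂ l).mul hp
  have hw {p : S} (hp : p.IsHomogeneous u) : (C κ * X 0 ^ m * p).IsHomogeneous (v + 1) := by
    rw [huv]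
    simpa using ((isHomogeneous_C (Fin 3) κ).mul ((isHomogeneous_X ℂ (0 : Fin 3)).pow m)).mul hp
  fin_cases j
  · exact (hX 2 (hA i)).sub (hX 1 (hB i))
  · exact (hX 1 (hD i)).sub (hw (hA i))
  · exact (hX 2 (hD i)).sub (hw (hB i))

/-- For `d₁ = 1` the first two monomials coincide and the curve is `2 x ^ d + y ^ (d - 1) z`, which
explains the constant `2 * (k + 2)`. -/
lemma curvePoly_one_isNearlyFreeWithExponents (k : ℕ) :
    IsNearlyFreeWithExponents (curvePoly (k + 2) 1 (k + 1)) 1 (k + 1) := by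
  have hk : (2 * (k + 2) : ℂ) ≠ 0 := by exact_mod_cast (by omega : 2 * (k + 2) ≠ 0)
  have hk' : (k + 1 : ℂ) ≠ 0 := by exact_mod_cast k.succ_ne_zero
  refine (isKoszulSystem_of_pderiv_monomial (k := k) hk hk' ?_ ?_ ?_
    ).isNearlyFreeWithExponents_of_isHomogeneous (curvePoly_irreducible _ _ _).squarefree
    (curvePoly_isHomogeneous le_rfl (by ring)) (e := k) (u := 0) (v := k) ?_ ?_ ?_ ?_ (by ring)
    (Nat.zero_le k)
  · simp [curvePoly, pderiv_X, C_ofNat]; ring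
  · simp [curvePoly, pderiv_X]; ring
  · simp [curvePoly, pderiv_X]
  · simpa using isHomogeneous_monomial_mul (c := (k + 1) * (2 * (k + 2))) 0 k 0 k (by simp)
  · intro i
    fin_cases i
    · exact isHomogeneous_zero _ _ _
    · exact isHomogeneous_zero _ _ _
    · exact isHomogeneous_C _ _
  · intro i
    fin_cases i
    · exact isHomogeneous_zero _ _ _
    · exact isHomogeneous_C _ _
    · exact isHomogeneous_zero _ _ _
  · intro i
    fin_cases i
    · simpa using isHomogeneous_monomial_mul (c := k + 1) 0 k 0 k (by simp)
    · exact isHomogeneous_zero _ _ _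
    · exact isHomogeneous_zero _ _ _

lemma isNearlyFreeWithExponents_of_pderiv_binomial {f : S} (hf : Squarefree f) {d n k : ℕ}
    {p q e s : ℂ} (hfd : f.IsHomogeneous d) (hp : p ≠ 0) (hq : q ≠ 0) (he : e ≠ 0) (hs : s ≠ 0)
    (h0 : pderiv 0 f = C p * X 0 ^ (2 * n + k + 3) + C q * X 0 ^ (n + k + 2) * X 1 ^ (n + 1))
    (h1 : pderiv 1 f = C s * X 0 ^ (n + k + 3) * X 1 ^ n + C e * X 1 ^ (2 * n + k + 2) * X 2)
    (h2 : pderiv 2 f = X 1 ^ (2 * n + k + 3)) :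
    IsNearlyFreeWithExponents f (n + 2) (n + k + 2) := by
  have hh : (C p * X 0 ^ (n + 1) + C q * X 1 ^ (n + 1) : S).IsHomogeneous (n + 1) := by
    have e₁ := isHomogeneous_monomial_mul (c := p) (n + 1) 0 0 (n + 1) (by omega)
    have e₂ := isHomogeneous_monomial_mul (c := q) 0 (n + 1) 0 (n + 1) (by omega)
    simpa only [pow_zero, mul_one] using e₁.add e₂
  have hh' : (C e * (C p * X 0 ^ (n + 1) + C q * X 1 ^ (n + 1)) : S).IsHomogeneous (n + 1) := by
    simpa only [zero_add] using (isHomogeneous_C (Fin 3) e).mul hh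
  refine (isKoszulSystem_of_pderiv_binomial hp hq he hs h0 h1 h2
    ).isNearlyFreeWithExponents_of_isHomogeneous hf hfd (u := n + 1)
    (v := n + k + 1) (hh'.mul ((isHomogeneous_X ℂ (1 : Fin 3)).pow (2 * n + k + 2))) ?_ ?_ ?_
    (by ring) (by omega)
  · intro i
    fin_cases i
    · exact isHomogeneous_zero _ _ _
    · exact isHomogeneous_zero _ _ _
    · exact hh'
  · intro i
    fin_cases i
    · simpa using (isHomogeneous_monomial_mul (c := s) 1 n 0 (n + 1) (by omega)).neg
    · exact hh
    · exact isHomogeneous_zero _ _ _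
  · intro i
    fin_cases i
    · simpa using isHomogeneous_monomial_mul (c := p * e * s) 0 (n + k + 1) 0 (n + k + 1)
        (by omega)
    · have e₁ := isHomogeneous_monomial_mul (c := p ^ 2 * e) n (k + 1) 0 (n + k + 1) (by omega)
      rw [pow_zero, mul_one] at e₁
      exact e₁.neg
    · have e₁ := isHomogeneous_monomial_mul (c := p ^ 2 * e ^ 2) n k 1 (n + k + 1) (by omega)
      have e₂ := isHomogeneous_monomial_mul (c := s * q ^ 2 * e) (k + 1) n 0 (n + k + 1)
        (by omega)
      rw [pow_one] at e₁
      rw [pow_zero, mul_one] at e₂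
      exact e₁.add e₂

lemma curvePoly_add_two_isNearlyFreeWithExponents (n k : ℕ) :
    IsNearlyFreeWithExponents (curvePoly (2 * n + k + 4) (n + 2) (n + k + 2)) (n + 2)
      (n + k + 2) := by
  refine isNearlyFreeWithExponents_of_pderiv_binomial (p := 2 * n + k + 4) (q := n + k + 3)
    (e := 2 * n + k + 3) (s := n + 1) (curvePoly_irreducible _ _ _).squarefree
    (curvePoly_isHomogeneous (by omega) (by ring)) ?_ ?_ ?_ ?_ ?_ ?_ ?_
  · exact_mod_cast (by omega : 2 * n + k + 4 ≠ 0)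
  · exact_mod_cast (by omega : n + k + 3 ≠ 0)
  · exact_mod_cast (by omega : 2 * n + k + 3 ≠ 0)
  · exact_mod_cast (by omega : n + 1 ≠ 0)
  · simp [curvePoly, pderiv_X, C_ofNat]; ring
  · simp [curvePoly, pderiv_X, C_ofNat]; ring
  · simp [curvePoly, pderiv_X]

lemma curvePoly_isNearlyFreeWithExponents {d d₁ d₂ : ℕ} (h₁ : 1 ≤ d₁) (h₂ : 2 * d₁ ≤ d)
    (h : d₁ + d₂ = d) : IsNearlyFreeWithExponents (curvePoly d d₁ d₂) d₁ d₂ := by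
  obtain rfl | h₁ := h₁.eq_or_lt
  · obtain ⟨k, rfl⟩ := Nat.exists_eq_add_of_le h₂
    obtain rfl : d₂ = k + 1 := by omega
    rw [show 2 * 1 + k = k + 2 by ring]
    exact curvePoly_one_isNearlyFreeWithExponents k
  · obtain ⟨n, rfl⟩ := Nat.exists_eq_add_of_le' h₁
    obtain ⟨k, rfl⟩ := Nat.exists_eq_add_of_le h₂
    obtain rfl : d₂ = n + k + 2 := by omega
    rw [show 2 * (n + 1 + 1) + k = 2 * n + k + 4 by ring]
    exact curvePoly_add_two_isNearlyFreeWithExponents n k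

/-! ### Rational curves -/

lemma aeval_mul_of_isHomogeneous {R : Type*} [CommRing R] [Algebra ℂ R] {p : S} {n : ℕ}
    (hp : p.IsHomogeneous n) (c : R) (t : Fin 3 → R) :
    aeval (fun i => c * t i) p = c ^ n * aeval t p := by
  simp only [aeval_def, eval₂_eq', Finset.mul_sum]
  refine Finset.sum_congr rfl fun m hm => ?_
  have hn : ∑ i, m i = n := by
    rw [← hp (mem_support_iff.1 hm), Finsupp.weight_apply, Finsupp.sum_fintype _ _ (by simp)]
    simp
  rw [← hn, ← Finset.prod_pow_eq_pow_sum, mul_left_comm, ← Finset.prod_mul_distrib]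
  simp only [mul_pow]

/-- The fraction field of the homogeneous coordinate ring of the curve `f = 0`. -/
abbrev CoordinateField (f : S) : Type := FractionRing (S ⧸ Ideal.span {f})

/-- If the function field contains a transcendental element `s` such that, after scaling, the
homogeneous coordinates of the generic point are rational functions of `s`, then the curve is
rational. -/
lemma isRational_of_transcendental {f : S} (hf : Irreducible f) [IsDomain (S ⧸ Ideal.span {f})]
    {s : CoordinateField f} (hs : Transcendental ℂ s) (hsf : s ∈ functionField f)
    (c : CoordinateField f) (t : Fin 3 → CoordinateField f)
    (ht : ∀ i, algebraMap (S ⧸ Ideal.span {f}) (CoordinateField f)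
      (Ideal.Quotient.mk (Ideal.span {f}) (X i)) = c * t i)
    (hts : ∀ i, ∃ p q : Polynomial ℂ, t i = Polynomial.aeval s p / Polynomial.aeval s q) :
    IsRational f := by
  refine ⟨hf, ?_⟩
  have hinj : Function.Injective (Polynomial.aeval (R := ℂ) s) :=
    transcendental_iff_injective.1 hs
  let Φ : RatFunc ℂ →ₐ[ℂ] CoordinateField f := RatFunc.liftAlgHom (Polynomial.aeval s)
    (nonZeroDivisors_le_comap_nonZeroDivisors_of_injective _ hinj)
  have hΦ (p q : Polynomial ℂ) : Φ (algebraMap _ _ p / algebraMap _ _ q) =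
      Polynomial.aeval s p / Polynomial.aeval s q := RatFunc.liftAlgHom_apply_div _ _ p q
  have hinv {q : CoordinateField f} (hq : q ∈ functionField f) : q⁻¹ ∈ functionField f := by
    rcases eq_or_ne q 0 with rfl | hq0
    · rw [inv_zero]; exact zero_mem _
    obtain ⟨n, a, b, ha, hb, hb0, hab⟩ := hq
    refine ⟨n, b, a, hb, ha, mem_nonZeroDivisors_iff_ne_zero.2 fun h0 => ?_, ?_⟩
    · rw [h0, map_zero, mul_eq_zero, or_iff_right hq0] at hab
      exact nonZeroDivisors.ne_zero hb0 (IsFractionRing.injective _ (CoordinateField f)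
        (by rw [hab, map_zero]))
    · rw [← hab, inv_mul_cancel_left₀ hq0]
  have hpoly (p : Polynomial ℂ) : Polynomial.aeval s p ∈ functionField f :=
    Algebra.adjoin_le (Set.singleton_subset_iff.2 hsf) (Polynomial.aeval_mem_adjoin_singleton ℂ s)
  have hrange : Φ.range = functionField f := by
    refine le_antisymm ?_ ?_
    · rintro _ ⟨r, rfl⟩
      change Φ r ∈ _
      rw [← RatFunc.num_div_denom r, hΦ, div_eq_mul_inv]
      exact mul_mem (hpoly _) (hinv (hpoly _))
    · rintro q ⟨n, a, b, ha, hb, hb0, hab⟩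
      have hval {p : S} (hp : p.IsHomogeneous n) :
          algebraMap (S ⧸ Ideal.span {f}) (CoordinateField f)
            (Ideal.Quotient.mk (Ideal.span {f}) p) = c ^ n * aeval t p := by
        rw [← aeval_mul_of_isHomogeneous hp]
        have : ((IsScalarTower.toAlgHom ℂ (S ⧸ Ideal.span {f}) (CoordinateField f)).comp
            (Ideal.Quotient.mkₐ ℂ (Ideal.span {f}))) = aeval fun i => c * t i := by
          refine algHom_ext fun i => ?_
          rw [aeval_X, ← ht]
          rfl
        exact DFunLike.congr_fun this p
      have hb0' : algebraMap (S ⧸ Ideal.span {f}) (CoordinateField f)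
          (Ideal.Quotient.mk (Ideal.span {f}) b) ≠ 0 :=
        fun h0 => nonZeroDivisors.ne_zero hb0 (IsFractionRing.injective _ (CoordinateField f) (by
          rw [h0, map_zero]))
      choose u v huv using hts
      have haeval (p : S) : aeval t p =
          -- In a quotient of two forms of degree `n` the common factor `c ^ n` cancels, so its
          -- value is a rational function of `s`.
          Φ (aeval (fun i => algebraMap _ (RatFunc ℂ) (u i) / algebraMap _ _ (v i)) p) := by
        rw [← AlgHom.comp_apply, comp_aeval]
        simp only [hΦ, ← huv]
      rw [hval hb] at hb0'
      rw [hval ha, hval hb, haeval a, haeval b] at hab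
      rw [haeval b] at hb0'
      refine ⟨aeval (fun i => algebraMap _ (RatFunc ℂ) (u i) / algebraMap _ _ (v i)) a /
        aeval (fun i => algebraMap _ (RatFunc ℂ) (u i) / algebraMap _ _ (v i)) b, ?_⟩
      change Φ _ = _
      rw [map_div₀, div_eq_iff (right_ne_zero_of_mul hb0')]
      refine mul_left_cancel₀ (left_ne_zero_of_mul hb0') ?_
      rw [← hab]
      ring
  exact ⟨((AlgEquiv.ofInjective Φ Φ.toRingHom.injective).trans
    (Subalgebra.equivOfEq _ _ hrange)).symm⟩

/-- The parametrization `t ↦ (t ^ (d - 1), t ^ d, -(1 + t ^ (d₁ - 1)))` of the curve. -/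
def curveParametrization (d d₁ : ℕ) : S →ₐ[ℂ] Polynomial ℂ :=
  aeval ![Polynomial.X ^ (d - 1), Polynomial.X ^ d, -(1 + Polynomial.X ^ (d₁ - 1))]

lemma curveParametrization_curvePoly {d d₁ d₂ : ℕ} (h₁ : 1 ≤ d₁) (h : d₁ + d₂ = d) :
    curveParametrization d d₁ (curvePoly d d₁ d₂) = 0 := by
  subst h
  obtain ⟨n, rfl⟩ := Nat.exists_eq_add_of_le' h₁
  have : n + 1 + d₂ - 1 = n + d₂ := by omega
  simp [curvePoly, curveParametrization, this]
  ring

lemma div_eq_of_curve_equation {F : Type*} [Field F] {x y z : F} {n e : ℕ} (hx : x ≠ 0)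
    (hy : y ≠ 0) (h : x ^ (n + 1 + e) + x ^ (e + 1) * y ^ n + y ^ (n + e) * z = 0) :
    z / x = -(1 + (y / x) ^ n) / (y / x) ^ (n + e) := by
  obtain ⟨s, rfl⟩ : ∃ s, y = s * x := ⟨y / x, (div_mul_cancel₀ y hx).symm⟩
  have hs : s ≠ 0 := left_ne_zero_of_mul hy
  rw [mul_div_cancel_right₀ s hx, div_eq_div_iff hx (pow_ne_zero _ hs)]
  refine mul_left_cancel₀ (pow_ne_zero (n + e) hx) ?_
  linear_combination h

lemma curvePoly_isRational {d d₁ d₂ : ℕ} (h₁ : 1 ≤ d₁) (h : d₁ + d₂ = d) :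
    IsRational (curvePoly d d₁ d₂) := by
  have hirr := curvePoly_irreducible d d₁ d₂
  have hker := curveParametrization_curvePoly h₁ h
  set f := curvePoly d d₁ d₂ with hf
  have : (Ideal.span {f}).IsPrime := (Ideal.span_singleton_prime hirr.ne_zero).2 hirr.prime
  have hdom : IsDomain (S ⧸ Ideal.span {f}) := Ideal.Quotient.isDomain _
  let ι : S →ₐ[ℂ] CoordinateField f :=
    (IsScalarTower.toAlgHom ℂ (S ⧸ Ideal.span {f}) (CoordinateField f)).comp
      (Ideal.Quotient.mkₐ ℂ (Ideal.span {f}))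
  have hι (p : S) :
      ι p = algebraMap _ (CoordinateField f) (Ideal.Quotient.mk (Ideal.span {f}) p) := rfl
  have hzero {p : S} (hp : ι p = 0) : curveParametrization d d₁ p = 0 := by
    rw [hι, FaithfulSMul.algebraMap_eq_zero_iff, Ideal.Quotient.eq_zero_iff_dvd] at hp
    obtain ⟨q, rfl⟩ := hp
    rw [map_mul, hker, zero_mul]
  have hx : ι (X 0) ≠ 0 := fun h0 => by simpa [curveParametrization] using hzero h0
  have hy : ι (X 1) ≠ 0 := fun h0 => by simpa [curveParametrization] using hzero h0
  have hfι : ι f = 0 := by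
    rw [hι, Ideal.Quotient.eq_zero_iff_mem.2 (Ideal.mem_span_singleton_self f), map_zero]
  have htr : Transcendental ℂ (ι (X 1) / ι (X 0)) := by
    -- Over an algebraically closed field an algebraic `y / x` would be a constant `c`. Then `y - c
    -- x` would vanish on the curve, but the parametrization pulls it back to `t ^ d - c t ^ (d - 1)
    -- ≠ 0`.
    intro halg
    obtain ⟨c, hc⟩ := minpoly.mem_range_of_degree_eq_one ℂ (ι (X 1) / ι (X 0))
      (IsAlgClosed.degree_eq_one_of_irreducible ℂ (minpoly.irreducible halg.isIntegral))
    have h0 := hzero (p := X 1 - C c * X 0) (by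
      rw [map_sub, map_mul, ← algebraMap_eq, ι.commutes, hc]
      field_simp
      ring)
    have h0 := congrArg (Polynomial.coeff · d) h0
    have hd : d ≠ d - 1 := by omega
    simp [curveParametrization, Polynomial.coeff_X_pow, hd] at h0
  refine isRational_of_transcendental hirr htr ?_ (ι (X 0))
    ![1, ι (X 1) / ι (X 0), ι (X 2) / ι (X 0)] (fun i => ?_) (fun i => ?_)
  · refine ⟨1, X 1, X 0, isHomogeneous_X _ _, isHomogeneous_X _ _,
      mem_nonZeroDivisors_iff_ne_zero.2 fun h0 => hx (by rw [hι, h0, map_zero]), ?_⟩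
    rw [← hι, ← hι, div_mul_cancel₀ _ hx]
  · rw [← hι]
    fin_cases i <;> simp [mul_div_cancel₀, hx]
  · fin_cases i
    · exact ⟨1, 1, by simp⟩
    · exact ⟨Polynomial.X, 1, by simp⟩
    · refine ⟨-(1 + Polynomial.X ^ (d₁ - 1)), Polynomial.X ^ (d - 1), ?_⟩
      subst h
      obtain ⟨n, rfl⟩ := Nat.exists_eq_add_of_le' h₁
      have e : n + 1 + d₂ - 1 = n + d₂ := by omega
      simp only [hf, curvePoly, map_add, map_mul, map_pow, e, Nat.add_sub_cancel] at hfι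
      simpa [e] using div_eq_of_curve_equation hx hy hfι

/-! ### The cusp -/

/-! ### Weighted orders and irreducibility of power series. -/

section PowerSeries

open MvPowerSeries

lemma weight_fin_two (a b : ℕ) (u : Fin 2 →₀ ℕ) :
    Finsupp.weight ![a, b] u = u 0 * a + u 1 * b := by
  rw [Finsupp.weight_apply, Finsupp.sum_fintype _ _ (by simp)]
  simp

lemma isUnit_of_weightedOrder_eq_zero {N : ℕ} (hN : N ≠ 0) {F : MvPowerSeries (Fin 2) ℂ}
    (hF : F.weightedOrder ![N, N + 1] = 0) : IsUnit F := by
  obtain ⟨u, hu, hu'⟩ := exists_coeff_ne_zero_and_weightedOrder (w := ![N, N + 1]) (f := F)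
    (by rw [hF]; rfl)
  rw [hF, weight_fin_two] at hu'
  have hu' : u 0 * N + u 1 * (N + 1) = 0 := by exact_mod_cast hu'
  have : u = 0 := by
    ext i
    fin_cases i
    · simpa [hN] using (Nat.add_eq_zero_iff.1 hu').1
    · simpa using (Nat.add_eq_zero_iff.1 hu').2
  rw [isUnit_iff_constantCoeff, isUnit_iff_ne_zero]
  rwa [this, coeff_zero_eq_constantCoeff_apply] at hu

/-- A monomial of minimal weight in a product can only come from monomials of minimal weight in the
factors. -/
lemma exists_weight_eq_of_coeff_mul_ne_zero {N : ℕ} {a b : MvPowerSeries (Fin 2) ℂ} {α β : ℕ}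
    (ha : a.weightedOrder ![N, N + 1] = α) (hb : b.weightedOrder ![N, N + 1] = β)
    {e : Fin 2 →₀ ℕ} (he : coeff e (a * b) ≠ 0)
    (hab : α + β = Finsupp.weight ![N, N + 1] e) :
    ∃ u v : Fin 2 →₀ ℕ, u + v = e ∧ Finsupp.weight ![N, N + 1] u = α := by
  rw [MvPowerSeries.coeff_mul] at he
  obtain ⟨⟨u, v⟩, huv, hne⟩ := Finset.exists_ne_zero_of_sum_ne_zero he
  replace huv : u + v = e := Finset.HasAntidiagonal.mem_antidiagonal.1 huv
  refine ⟨u, v, huv, ?_⟩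
  have h1 : a.weightedOrder ![N, N + 1] ≤ Finsupp.weight ![N, N + 1] u :=
    weightedOrder_le _ (left_ne_zero_of_mul hne)
  have h2 : b.weightedOrder ![N, N + 1] ≤ Finsupp.weight ![N, N + 1] v :=
    weightedOrder_le _ (right_ne_zero_of_mul hne)
  rw [ha, Nat.cast_le] at h1
  rw [hb, Nat.cast_le] at h2
  rw [← huv, map_add] at hab
  omega

/-- A power series whose Newton polygon is the segment from `(N + 1, 0)` to `(0, N)` is
irreducible. -/
lemma irreducible_of_newtonPolygon {N : ℕ} (hN : N ≠ 0) {F : MvPowerSeries (Fin 2) ℂ}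
    (h0 : coeff (Finsupp.single 0 (N + 1)) F ≠ 0) (h1 : coeff (Finsupp.single 1 N) F ≠ 0)
    (h : ∀ e, coeff e F ≠ 0 → N * (N + 1) ≤ Finsupp.weight ![N, N + 1] e) : Irreducible F := by
  have hw0 : Finsupp.weight ![N, N + 1] (Finsupp.single (0 : Fin 2) (N + 1)) = N * (N + 1) := by
    simp [weight_fin_two]; ring
  have hw1 : Finsupp.weight ![N, N + 1] (Finsupp.single (1 : Fin 2) N) = N * (N + 1) := by
    simp [weight_fin_two]
  have hF : F.weightedOrder ![N, N + 1] = (N * (N + 1) : ℕ) := by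
    refine le_antisymm ?_ ?_
    · rw [← hw0]; exact weightedOrder_le _ h0
    · refine nat_le_weightedOrder _ fun e he => ?_
      by_contra hne
      exact absurd (h e hne) (by omega)
  refine ⟨fun hu => ?_, fun {a b} hab => ?_⟩
  · have h00 := h 0 (by
      rw [coeff_zero_eq_constantCoeff_apply]
      exact (isUnit_iff_constantCoeff.1 hu).ne_zero)
    simp [hN] at h00
  · rw [hab, weightedOrder_mul] at hF
    obtain ⟨α, hα⟩ := ENat.ne_top_iff_exists.1 (show a.weightedOrder ![N, N + 1] ≠ ⊤ from
      fun ht => by rw [ht, top_add] at hF; exact ENat.top_ne_natCast _ hF)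
    obtain ⟨β, hβ⟩ := ENat.ne_top_iff_exists.1 (show b.weightedOrder ![N, N + 1] ≠ ⊤ from
      fun ht => by rw [ht, add_top] at hF; exact ENat.top_ne_natCast _ hF)
    rw [← hα, ← hβ] at hF
    have hαβ : α + β = N * (N + 1) := by exact_mod_cast hF
    rw [hab] at h0 h1
    obtain ⟨u, u', hu, huα⟩ := exists_weight_eq_of_coeff_mul_ne_zero hα.symm hβ.symm h0
      (by rw [hw0, hαβ])
    obtain ⟨v, v', hv, hvα⟩ := exists_weight_eq_of_coeff_mul_ne_zero hα.symm hβ.symm h1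
      (by rw [hw1, hαβ])
    rw [weight_fin_two] at huα hvα
    have hu0 : u 0 + u' 0 = N + 1 := by simpa using DFunLike.congr_fun hu 0
    have hu1 : u 1 + u' 1 = 0 := by simpa using DFunLike.congr_fun hu 1
    have hv0 : v 0 + v' 0 = 0 := by simpa using DFunLike.congr_fun hv 0
    obtain ⟨hu1, -⟩ := Nat.add_eq_zero_iff.1 hu1
    obtain ⟨hv0, -⟩ := Nat.add_eq_zero_iff.1 hv0
    rw [hu1, zero_mul, add_zero] at huα
    rw [hv0, zero_mul, zero_add] at hvα
    -- The order `α` of `a` is read off twice, from a pure power of each variable: `u 0 * N = v 1 *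
    -- (N + 1)`. As `N` and `N + 1` are coprime and `u 0 ≤ N + 1`, one factor has order zero.
    have hdvd : N + 1 ∣ u 0 := (Nat.coprime_self_add_left.2 (Nat.coprime_one_left N)
      ).dvd_of_dvd_mul_right ⟨v 1, by rw [huα, ← hvα, mul_comm]⟩
    rcases Nat.eq_zero_or_pos (u 0) with hz | hz
    · left
      refine isUnit_of_weightedOrder_eq_zero hN ?_
      rw [← hα, ← huα, hz, zero_mul, Nat.cast_zero]
    · right
      have := Nat.le_of_dvd hz hdvd
      have hN1 : u 0 = N + 1 := by omega
      refine isUnit_of_weightedOrder_eq_zero hN ?_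
      have : β = 0 := by
        rw [hN1, mul_comm] at huα
        omega
      rw [← hβ, this, Nat.cast_zero]

end PowerSeries

lemma cusp_equation_irreducible {d d₁ d₂ : ℕ} (hd : 2 ≤ d) (h₁ : 1 ≤ d₁) (h : d₁ + d₂ = d) :
    Irreducible ((X 0 ^ d + X 0 ^ (d₂ + 1) * X 1 ^ (d₁ - 1) + X 1 ^ (d - 1) :
      MvPolynomial (Fin 2) ℂ) : MvPowerSeries (Fin 2) ℂ) := by
  obtain ⟨N, rfl⟩ := Nat.exists_eq_add_of_le' (show 1 ≤ d by omega)
  obtain ⟨m, rfl⟩ := Nat.exists_eq_add_of_le' h₁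
  have hN : N = m + d₂ := by omega
  have hcoeff (e : Fin 2 →₀ ℕ) : coeff e (X 0 ^ (N + 1) + X 0 ^ (d₂ + 1) * X 1 ^ m + X 1 ^ N :
      MvPolynomial (Fin 2) ℂ) = (if Finsupp.single 0 (N + 1) = e then 1 else 0) +
      (if Finsupp.single 0 (d₂ + 1) + Finsupp.single 1 m = e then 1 else 0) +
      (if Finsupp.single 1 N = e then 1 else 0) := by
    simp only [X_pow_eq_monomial, monomial_mul, one_mul, coeff_add, coeff_monomial]
  simp only [Nat.add_sub_cancel]
  refine irreducible_of_newtonPolygon (N := N) (by omega) ?_ ?_ fun e he => ?_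
  · rw [coeff_coe, hcoeff, if_pos rfl, if_neg (c := Finsupp.single 1 N = _)]
    · split_ifs <;> norm_num
    · intro h0
      have := DFunLike.congr_fun h0 0
      simp at this
  · rw [coeff_coe, hcoeff, if_pos rfl, if_neg, if_neg]
    · norm_num
    · intro h0
      have := DFunLike.congr_fun h0 0
      simp at this
    · intro h0
      have := DFunLike.congr_fun h0 0
      simp at this
  · rw [coeff_coe, hcoeff] at he
    rw [weight_fin_two]
    by_cases e1 : Finsupp.single 0 (N + 1) = e
    · subst e1; simp; linarith
    by_cases e2 : Finsupp.single 0 (d₂ + 1) + Finsupp.single 1 m = e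
    -- The mixed monomial has weight `N (N + 1) + m`, so it lies on or above the segment.
    · subst e2; subst hN; simp; nlinarith
    by_cases e3 : Finsupp.single 1 N = e
    · subst e3; simp
    rw [if_neg e1, if_neg e2, if_neg e3] at he
    simp at he

/-- The Puiseux parametrization of the cusp, found by Hensel lifting. -/
lemma exists_puiseux_unit {n m : ℕ} (hnm : m < n) : ∃ ψ : PowerSeries ℂ,
    PowerSeries.constantCoeff ψ ≠ 0 ∧ ψ ^ n + PowerSeries.X ^ m * ψ ^ m + 1 = 0 := by
  have hn : n ≠ 0 := by omega
  -- The convention `0 ^ 0 = 1` unifies two reductions modulo `X`: `ψ ^ n + 2 = 0` for `m = 0` and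
  -- `ψ ^ n + 1 = 0` otherwise. The root `c` is nonzero, hence simple.
  obtain ⟨c, hc⟩ := IsAlgClosed.exists_pow_nat_eq (-(1 + 0 ^ m) : ℂ) (Nat.pos_of_ne_zero hn)
  have hcm : (0 ^ m * c ^ m : ℂ) = 0 ^ m := by
    rcases Nat.eq_zero_or_pos m with rfl | hm
    · simp
    · simp [hm.ne']
  have hc0 : c ≠ 0 := by
    rintro rfl
    rw [zero_pow hn] at hc
    rcases Nat.eq_zero_or_pos m with rfl | hm
    · norm_num at hc
    · norm_num [hm.ne'] at hc
  have hmem (q : PowerSeries ℂ) :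
      q ∈ Ideal.span {(PowerSeries.X : PowerSeries ℂ)} ↔ PowerSeries.constantCoeff q = 0 := by
    rw [Ideal.mem_span_singleton, PowerSeries.X_dvd_iff]
  let P : Polynomial (PowerSeries ℂ) := Polynomial.X ^ n +
    (Polynomial.C (PowerSeries.X ^ m) * Polynomial.X ^ m + 1)
  have hP : P.Monic := by
    refine Polynomial.monic_X_pow_add ((Polynomial.degree_add_le _ _).trans_lt (max_lt ?_ ?_))
    · exact (Polynomial.degree_C_mul_X_pow_le _ _).trans_lt (by exact_mod_cast hnm)
    · exact Polynomial.degree_one_le.trans_lt (by exact_mod_cast Nat.pos_of_ne_zero hn)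
  obtain ⟨ψ, hψ, hψc⟩ := HenselianRing.is_henselian
    (I := Ideal.span {(PowerSeries.X : PowerSeries ℂ)}) P hP (PowerSeries.C c) (by
      rw [hmem]
      simp [P, hc]
      linear_combination hcm) (by
      refine IsUnit.map _ (PowerSeries.isUnit_iff_constantCoeff.2 ?_)
      have h0 : (0 ^ m * m : ℂ) = 0 := by
        rcases Nat.eq_zero_or_pos m with rfl | hm
        · simp
        · simp [hm.ne']
      rw [isUnit_iff_ne_zero]
      simp only [P, Polynomial.derivative_add, Polynomial.derivative_C_mul,
        Polynomial.derivative_X_pow, Polynomial.derivative_one]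
      simp [← mul_assoc, h0, hn, hc0])
  rw [hmem, map_sub, PowerSeries.constantCoeff_C, sub_eq_zero] at hψc
  refine ⟨ψ, by rwa [hψc], ?_⟩
  simpa [P, Polynomial.IsRoot, add_assoc] using hψ

lemma isFrameAt_single : IsFrameAt (fun i => Pi.single i 1)
    (Projectivization.mk ℂ (![0, 0, 1] : Fin 3 → ℂ) (fun h => by simpa using congrFun h 2)) := by
  refine ⟨Pi.linearIndependent_single_one _ _, ?_⟩
  rw [Projectivization.submodule_mk, Submodule.mem_span_singleton]
  refine ⟨1, ?_⟩
  ext i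
  fin_cases i <;> simp

lemma localEquation_curvePoly (d d₁ d₂ : ℕ) :
    localEquation (curvePoly d d₁ d₂) (fun i => Pi.single i 1) =
      X 0 ^ d + X 0 ^ (d₂ + 1) * X 1 ^ (d₁ - 1) + X 1 ^ (d - 1) := by
  simp [localEquation, curvePoly]

lemma curvePoly_isSingularPoint_iff {d d₁ d₂ : ℕ} (hd : 3 ≤ d) (h₁ : 1 ≤ d₁)
    (h₂ : d₁ + d₂ = d) (hd₂ : d₁ ≤ d₂) (q : P2) :
    IsSingularPoint (curvePoly d d₁ d₂) q ↔ q = Projectivization.mk ℂ (![0, 0, 1] : Fin 3 → ℂ)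
      (fun h => by simpa using congrFun h 2) := by
  have e1 : d - 1 ≠ 0 := by omega
  have e2 : d - 1 - 1 ≠ 0 := by omega
  have e3 : d₂ ≠ 0 := by omega
  have e4 : d ≠ 0 := by omega
  constructor
  · rintro ⟨-, hq⟩
    have hy : q.rep 1 = 0 := by simpa [curvePoly, pderiv_X, e1] using hq 2
    have hx : q.rep 0 = 0 := by
      have h0 := hq 0
      -- For `d₁ = 1` both terms of `f_x` are multiples of `x ^ (d - 1)`; otherwise the second one
      -- vanishes with `y`.
      rcases Nat.eq_zero_or_pos (d₁ - 1) with hm | hm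
      · have hd' : d - 1 = d₂ := by omega
        have hc : (d + (d₂ + 1) : ℂ) ≠ 0 := by exact_mod_cast (by omega : d + (d₂ + 1) ≠ 0)
        simp [curvePoly, pderiv_X, hm, hd'] at h0
        rw [← add_mul] at h0
        exact (pow_eq_zero_iff e3).1 ((mul_eq_zero.1 h0).resolve_left hc)
      · simpa [curvePoly, pderiv_X, hy, hm.ne', e4, e1] using h0
    rw [← q.mk_rep, Projectivization.mk_eq_mk_iff']
    refine ⟨q.rep 2, ?_⟩
    ext i
    fin_cases i <;> simp [hx, hy]
  · rintro rfl
    obtain ⟨a, ha⟩ := Projectivization.exists_smul_eq_mk_rep ℂ (![0, 0, 1] : Fin 3 → ℂ)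
      (fun h => by simpa using congrFun h 2)
    rw [IsSingularPoint, ← ha]
    refine ⟨by simp [curvePoly, e1, e4], fun i => ?_⟩
    fin_cases i <;> simp [curvePoly, pderiv_X, e1, e2, e3]

lemma curvePoly_hasUniquePuiseuxPair {d d₁ d₂ : ℕ} (hd : 3 ≤ d) (h₁ : 1 ≤ d₁)
    (h₂ : d₁ + d₂ = d) (hd₂ : d₁ ≤ d₂) :
    HasUniquePuiseuxPair (curvePoly d d₁ d₂) (Projectivization.mk ℂ (![0, 0, 1] : Fin 3 → ℂ)
      (fun h => by simpa using congrFun h 2)) (d - 1) d := by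
  refine ⟨by omega, by omega, ?_, _, isFrameAt_single, ?_, ?_⟩
  · obtain ⟨n, rfl⟩ := Nat.exists_eq_add_of_le' (show 1 ≤ d by omega)
    simp
  · rw [localEquation_curvePoly]
    exact cusp_equation_irreducible (by omega) h₁ h₂
  · obtain ⟨ψ, hψ0, hψ⟩ := exists_puiseux_unit (n := d - 1) (m := d₁ - 1) (by omega)
    -- Substituting `u = t ^ (d - 1)`, `v = t ^ d ψ` makes the local equation `t ^ (d (d - 1))`
    -- times the equation of `ψ`. Since `ψ` is a unit, the series for `v` has order exactly `d`.
    refine ⟨PowerSeries.X ^ d * ψ, ?_, ?_, fun j hj _ => ?_, ?_⟩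
    · rw [PowerSeries.coeff_X_pow_mul', if_neg (by omega)]
    · rw [localEquation_curvePoly]
      obtain ⟨n, rfl⟩ := Nat.exists_eq_add_of_le' h₁
      obtain rfl := h₂
      have e : n + 1 + d₂ - 1 = n + d₂ := by omega
      simp [e] at hψ ⊢
      linear_combination PowerSeries.X ^ ((n + d₂) * (n + 1 + d₂)) * hψ
    · rw [PowerSeries.coeff_X_pow_mul', if_neg (by omega)]
    · rw [PowerSeries.coeff_X_pow_mul', if_pos le_rfl, Nat.sub_self]
      simpa using hψ0

end PlaneCurve

end

theorem theorem3p1 (d d₁ d₂ : ℕ) (h₁ : 1 ≤ d₁) (h₂ : 2 * d₁ ≤ d) (h₃ : d₂ = d - d₁) :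
    (PlaneCurve.curvePoly d d₁ d₂).IsHomogeneous d ∧
    Irreducible (PlaneCurve.curvePoly d d₁ d₂) ∧
    PlaneCurve.IsNearlyFreeWithExponents (PlaneCurve.curvePoly d d₁ d₂) d₁ d₂ ∧
    PlaneCurve.IsRational (PlaneCurve.curvePoly d d₁ d₂) ∧
    (3 ≤ d → ∃ p : PlaneCurve.P2,
      PlaneCurve.IsCusp (PlaneCurve.curvePoly d d₁ d₂) p ∧
      (∀ q : PlaneCurve.P2,
        PlaneCurve.IsSingularPoint (PlaneCurve.curvePoly d d₁ d₂) q → q = p) ∧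
      PlaneCurve.HasUniquePuiseuxPair (PlaneCurve.curvePoly d d₁ d₂) p (d - 1) d) := by
  have h : d₁ + d₂ = d := by omega
  refine ⟨PlaneCurve.curvePoly_isHomogeneous h₁ h, PlaneCurve.curvePoly_irreducible d d₁ d₂,
    PlaneCurve.curvePoly_isNearlyFreeWithExponents h₁ h₂ h, PlaneCurve.curvePoly_isRational h₁ h,
    fun hd => ?_⟩
  have hsing := PlaneCurve.curvePoly_isSingularPoint_iff hd h₁ h (by omega)
  have hpair := PlaneCurve.curvePoly_hasUniquePuiseuxPair hd h₁ h (by omega)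
  obtain ⟨w, hw, hirr, -⟩ := hpair.2.2.2
  exact ⟨_, ⟨(hsing _).2 rfl, w, hw, hirr⟩, fun q => (hsing q).1, hpair⟩
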